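/- Let $n\ge 1$ and let $\mu\subseteq\lambda$ be partitions, drawn as Young diagrams in English notation. An \emph{$n$-ribbon} is a connected skew shape with $n$ boxes that contains no $2\times 2$ square; its \emph{spin} is the number of rows it occupies minus one. A tiling of a skew shape by $n$-ribbons is a \emph{horizontal ribbon strip} if the top-right-most box of each ribbon touches the northern boundary of the shape (no box of the shape lies directly above it), and a \emph{vertical ribbon strip} if the bottom-left-most box of each ribbon touches the western boundary of the shape (no box of the shape lies directly to its left). Let $A=\{1<\dots<r\}$ and $A'=\{1'<\dots<s'\}$, and let $\prec$ be a total order on the disjoint union $A\sqcup A'$ extending the orders of $A$ and of $A'$. A \emph{super $n$-ribbon tableau} of shape $\lambda/\mu$ (with respect to $\prec$) is a tiling $T$ of $\lambda/\mu$ by $n$-ribbons, each labelled by an element of $A\sqcup A'$, such that for each $a\in A$ the ribbons labelled $a$ form a horizontal ribbon strip, for each $b\in A'$ the ribbons labelled $b$ form a vertical ribbon strip, and for each $k\in A\sqcup A'$ the ribbons with label $\preceq k$ together cover a skew shape $\nu/\mu$ for some partition $\nu\supseteq\mu$. Let $\mathrm{spin}(T)$ be the sum of the spins of the ribbons of $T$,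 and for $a\in A$, $b\in A'$ let $\mathrm{wt}(T)_a$ and $\mathrm{wt}'(T)_b$ be the numbers of ribbons labelled $a$ and $b$. The \emph{super LLT polynomial} is $$\mathcal G^{(n)}_{\lambda/\mu}(X/Y;q)=\sum_{T} q^{\mathrm{spin}(T)}\prod_{a\in A}x_a^{\mathrm{wt}(T)_a}\prod_{b\in A'}(-y_b)^{\mathrm{wt}'(T)_b}\in\mathbb Z[q][x_1,\dots,x_r,y_{1'},\dots,y_{s'}],$$ the sum being over all super $n$-ribbon tableaux $T$ of shape $\lambda/\mu$ with respect to $\prec$. Then, for every such $\prec$, the polynomial $\mathcal G^{(n)}_{\lambda/\mu}(X/Y;q)$ is invariant under all permutations of the variables $x_1,\dots,x_r$ and under all permutations of the variables $y_{1'},\dots,y_{s'}$. Moreover it does not depend on $\prec$: any two total orders on $A\sqcup A'$ extending the orders of $A$ and $A'$ give the same polynomial. -/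

import Mathlib

open Finset

namespace SuperLLT

/-- The boxes of the skew diagram `lam / mu`. A box is `(row, column)`, rows numbered downwards
and columns to the right, starting from `0`. -/
def skewCells (lam mu : YoungDiagram) : Finset (ℕ × ℕ) := lam.cells \ mu.cells

/-- A finite set of boxes is a skew shape if it is the diagram of some `lam / mu`
with `mu ⊆ lam`. -/
def IsSkewShape (R : Finset (ℕ × ℕ)) : Prop :=
  ∃ lam mu : YoungDiagram, mu ≤ lam ∧ R = skewCells lam mu

/-- An `n`-ribbon: a connected skew shape with `n` boxes and no `2 × 2` square. In the Hasse
diagram of `ℕ × ℕ` two boxes are adjacent exactly when they share an edge. -/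
structure IsRibbon (n : ℕ) (R : Finset (ℕ × ℕ)) : Prop where
  isSkewShape : IsSkewShape R
  card_eq : R.card = n
  connected : ((SimpleGraph.hasse (ℕ × ℕ)).induce (R : Set (ℕ × ℕ))).Connected
  no_square : ∀ i j : ℕ,
    ¬ ((i, j) ∈ R ∧ (i, j + 1) ∈ R ∧ (i + 1, j) ∈ R ∧ (i + 1, j + 1) ∈ R)

/-- The spin of a ribbon: its height (number of rows that it meets) minus one. -/
def spin (R : Finset (ℕ × ℕ)) : ℕ := (R.image Prod.fst).card - 1

/-- `c` is the top-right-most box of `R`. -/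
def IsTopRight (R : Finset (ℕ × ℕ)) (c : ℕ × ℕ) : Prop :=
  c ∈ R ∧ ∀ d ∈ R, c.1 ≤ d.1 ∧ d.2 ≤ c.2

/-- `c` is the bottom-left-most box of `R`. -/
def IsBottomLeft (R : Finset (ℕ × ℕ)) (c : ℕ × ℕ) : Prop :=
  c ∈ R ∧ ∀ d ∈ R, d.1 ≤ c.1 ∧ c.2 ≤ d.2

/-- The box `c` touches the northern boundary of the shape `S`: no box of `S` lies directly
above it. -/
def TouchesNorth (S : Finset (ℕ × ℕ)) (c : ℕ × ℕ) : Prop :=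
  ∀ i : ℕ, i + 1 = c.1 → (i, c.2) ∉ S

/-- The box `c` touches the western boundary of the shape `S`: no box of `S` lies directly
to the left of it. -/
def TouchesWest (S : Finset (ℕ × ℕ)) (c : ℕ × ℕ) : Prop :=
  ∀ j : ℕ, j + 1 = c.2 → (c.1, j) ∉ S

/-- The ribbons in `P` (tiles of the shape that they cover) form a horizontal ribbon strip. -/
def IsHorizontalStrip (P : Finset (Finset (ℕ × ℕ))) : Prop :=
  ∀ R ∈ P, ∃ c, IsTopRight R c ∧ TouchesNorth (P.sup id) c

/-- The ribbons in `P` (tiles of the shape that they cover) form a vertical ribbon strip;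
this is the transpose of `IsHorizontalStrip`. -/
def IsVerticalStrip (P : Finset (Finset (ℕ × ℕ))) : Prop :=
  ∀ R ∈ P, ∃ c, IsBottomLeft R c ∧ TouchesWest (P.sup id) c

/-- A total order on the disjoint union of the alphabets `A = {1, …, r}` and
`A' = {1', …, s'}` that extends the given orders of `A` and of `A'`. -/
structure RespectsAlphabets {r s : ℕ} (o : LinearOrder (Fin r ⊕ Fin s)) : Prop where
  inl_le : ∀ i j : Fin r, i ≤ j → o.le (Sum.inl i) (Sum.inl j)
  inr_le : ∀ i j : Fin s, i ≤ j → o.le (Sum.inr i) (Sum.inr j)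

/-- A super `n`-ribbon tableau of shape `lam / mu` for the total order `o` on `A ⊔ A'`. -/
@[ext]
structure SuperRibbonTableau (n : ℕ) (lam mu : YoungDiagram) {r s : ℕ}
    (o : LinearOrder (Fin r ⊕ Fin s)) where
  /-- the tiling -/
  tiling : Finpartition (skewCells lam mu)
  /-- the labels of the tiles -/
  label : {R // R ∈ tiling.parts} → Fin r ⊕ Fin s
  ribbon : ∀ R ∈ tiling.parts, IsRibbon n R
  horizontal : ∀ a : Fin r,
    IsHorizontalStrip ((univ.filter fun R => label R = Sum.inl a).image Subtype.val)
  vertical : ∀ b : Fin s,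
    IsVerticalStrip ((univ.filter fun R => label R = Sum.inr b).image Subtype.val)
  /-- Removing the ribbons with label larger than `k` leaves a skew shape `nu / mu`. -/
  initial : ∀ k : Fin r ⊕ Fin s, ∃ nu : YoungDiagram, mu ≤ nu ∧
    ∀ c : ℕ × ℕ, c ∈ skewCells nu mu ↔ ∃ R, o.le (label R) k ∧ c ∈ R.1

/-- The tiling and the labels determine the tableau. -/
theorem SuperRibbonTableau.toSigma_injective (n : ℕ) (lam mu : YoungDiagram) {r s : ℕ}
    (o : LinearOrder (Fin r ⊕ Fin s)) :
    Function.Injective (fun T : SuperRibbonTableau n lam mu o =>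
      (⟨T.tiling, T.label⟩ :
        Σ P : Finpartition (skewCells lam mu), ({R // R ∈ P.parts} → Fin r ⊕ Fin s))) := by
  rintro ⟨P, f, _, _, _, _⟩ ⟨Q, g, _, _, _, _⟩ h
  simp only [Sigma.mk.injEq] at h
  obtain ⟨rfl, h⟩ := h
  cases h
  rfl

noncomputable instance (n : ℕ) (lam mu : YoungDiagram) {r s : ℕ}
    (o : LinearOrder (Fin r ⊕ Fin s)) : Fintype (SuperRibbonTableau n lam mu o) :=
  Fintype.ofInjective _ (SuperRibbonTableau.toSigma_injective n lam mu o)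

namespace SuperRibbonTableau

variable {n : ℕ} {lam mu : YoungDiagram} {r s : ℕ} {o : LinearOrder (Fin r ⊕ Fin s)}

/-- The spin of a tableau is the sum of the spins of its ribbons. -/
def spin (T : SuperRibbonTableau n lam mu o) : ℕ := ∑ R ∈ T.tiling.parts, SuperLLT.spin R

/-- The number of ribbons with label `k`. For `k` in `A` this is the entry of the weight `wt(T)`,
for `k` in `A'` that of `wt'(T)`. -/
def wt (T : SuperRibbonTableau n lam mu o) (k : Fin r ⊕ Fin s) : ℕ :=
  (univ.filter fun R => T.label R = k).card

end SuperRibbonTableau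

/-- The super LLT polynomial of shape `lam / mu`, as a polynomial over `ℤ[q]` in the variables
`x_a` (`Sum.inl a`) and `y_b` (`Sum.inr b`). -/
noncomputable def superLLT (n : ℕ) (lam mu : YoungDiagram) {r s : ℕ}
    (o : LinearOrder (Fin r ⊕ Fin s)) : MvPolynomial (Fin r ⊕ Fin s) (Polynomial ℤ) :=
  ∑ T : SuperRibbonTableau n lam mu o,
    MvPolynomial.C (Polynomial.X ^ T.spin) *
      (∏ a : Fin r, MvPolynomial.X (Sum.inl a) ^ T.wt (Sum.inl a)) *
      ∏ b : Fin s, (-MvPolynomial.X (Sum.inr b)) ^ T.wt (Sum.inr b)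

end SuperLLT

/-! Encode a partition by its boundary word, a set of beads on `ℤ`. Adding an `n`-ribbon with
smallest content `i` moves a bead from `i` to `i + n`, and the spin is the number of beads jumped
over. Let `u i` be the resulting operator, weighted by `q ^ spin`. In a tableau the ribbons of one
label can be added one at a time in a forced order: increasing content for a horizontal strip,
decreasing content for a vertical one. So the strips of a label in `A` have generating operator
`H(x)`, the product of the factors `1 + x u i` with `i` decreasing from left to right. Those of a
label in `A'` with weight `-y` give the product of the `1 - y u i` in the opposite order. Since `u i
^ 2 = 0`, this is `H(y)⁻¹`. The super LLT polynomial is therefore a matrix coefficient, from `mu` to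
`lam`, of a product of operators `H(x_a)` and `H(y_b)⁻¹` (`sum_fillings_eq`).

All claims follow once these operators commute. This uses only three facts: `u i ^ 2 = 0`, `u i * u
j * u i = 0`, and that the commutator of `u j` and `u i` commutes with `u m` for `m` strictly
between `i` and `j`. Moving `1 + y u a` to the left through the rest of `H(x)` produces commutator
factors in which `x` and `y` enter only through `x y`, so induction on the list gives `H(x) H(y) =
H(y) H(x)` (`factorProd_commute`). The commutator relation comes from `u j * u i = q ^ 2 • (u i * u
j)` for `i < j < i + n` and from commutation for `j > i + n`.

The combinatorial half identifies tableaux with chains of bead moves: the last ribbon of a tableau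
can be removed (`IsFilling.erase`), and a later ribbon can be added (`IsFilling.insert`). -/

namespace SuperLLT

/-! ### Commuting ordered products of factors `1 + x u i` -/

section FactorProd

variable {ι S A : Type*} [CommRing S] [Ring A] [Algebra S A] (u : ι → A)

/-- The ordered product of the factors `1 + x u_i` along a list. -/
def factorProd (x : S) (l : List ι) : A := (l.map fun i => 1 + x • u i).prod

variable {u}

/-- After expansion, every word in `u i` and `u j` of length at least three contains a square or an
alternating `aba`, so it vanishes. -/
theorem factor_mul_factor (hsq : ∀ i, u i * u i = 0) (haba : ∀ i j, u i * u j * u i = 0)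
    (x y : S) (i j : ι) :
    (1 + x • u j) * (1 + y • u i) =
      (1 + y • u i) * (1 + (x * y) • (u j * u i - u i * u j)) * (1 + x • u j) := by
  have h2 : ∀ a, a * u j * u j = 0 := fun a => by rw [mul_assoc, hsq, mul_zero]
  simp only [mul_add, add_mul, mul_sub, sub_mul, smul_mul_assoc, mul_smul_comm, ← mul_assoc,
    one_mul, mul_one, smul_sub, hsq, haba, h2, smul_zero, zero_mul]
  module

/-- The factor at `a` passes the factors of `l` one by one, leaving a commutator factor each time.
By `hcomm` the factors still to its left commute with these, so the commutator factors collect in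
the middle. -/
theorem factorProd_mul_factor (hsq : ∀ i, u i * u i = 0) (haba : ∀ i j, u i * u j * u i = 0)
    {r : ι → ι → Prop}
    (hcomm : ∀ i m j, r i m → r m j → Commute (u m) (u j * u i - u i * u j))
    (x y : S) (a : ι) (l : List ι) (hl : (a :: l).Pairwise r) :
    factorProd u x l * (1 + y • u a) =
      (1 + y • u a) * (l.map fun j => 1 + (x * y) • (u j * u a - u a * u j)).prod *
        factorProd u x l := by
  induction l with
  | nil => simp [factorProd]
  | cons b l ih =>
    have hl' : (a :: l).Pairwise r := hl.sublist (by simp)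
    rw [List.pairwise_cons, List.pairwise_cons] at hl
    have hb : Commute (1 + x • u b)
        (l.map fun j => 1 + (x * y) • (u j * u a - u a * u j)).prod := by
      refine Commute.list_prod_right _ _ fun c hc => ?_
      obtain ⟨j, hj, rfl⟩ := List.mem_map.1 hc
      refine (Commute.one_left _).add_left (Commute.smul_left ?_ x)
      refine (Commute.one_right _).add_right (Commute.smul_right ?_ _)
      exact hcomm a b j (hl.1 b (by simp)) (hl.2.1 j hj)
    have ih' := ih hl'
    simp only [factorProd, List.map_cons, List.prod_cons] at ih' ⊢
    rw [mul_assoc, ih', ← mul_assoc, ← mul_assoc, factor_mul_factor hsq haba]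
    simp only [mul_assoc]
    rw [← mul_assoc (1 + x • u b), hb.eq]
    simp only [mul_assoc]

/-- The ordered products of the factors `1 + x u_i` commute for different values of `x`. -/
theorem factorProd_commute (hsq : ∀ i, u i * u i = 0) (haba : ∀ i j, u i * u j * u i = 0)
    {r : ι → ι → Prop}
    (hcomm : ∀ i m j, r i m → r m j → Commute (u m) (u j * u i - u i * u j))
    (x y : S) (l : List ι) (hl : l.Pairwise r) :
    Commute (factorProd u x l) (factorProd u y l) := by
  induction l with
  | nil => simp [factorProd]
  | cons a l ih =>
    have ih' := ih (List.pairwise_cons.1 hl).2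
    have hx := factorProd_mul_factor hsq haba hcomm x y a l hl
    have hy := factorProd_mul_factor hsq haba hcomm y x a l hl
    have ha : (1 + x • u a) * (1 + y • u a) = (1 + y • u a) * (1 + x • u a) := by
      simp [mul_add, add_mul, hsq]; abel
    -- The commutator factors depend on `x` and `y` only through the product, so `hx` and `hy` now
    -- share the same middle term.
    rw [mul_comm y x] at hy
    have cons_eq : ∀ z : S, factorProd u z (a :: l) = (1 + z • u a) * factorProd u z l :=
      fun z => by simp [factorProd]
    rw [Commute, SemiconjBy, cons_eq, cons_eq]
    calc _ = (1 + x • u a) * (factorProd u x l * (1 + y • u a)) * factorProd u y l := by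
          simp only [mul_assoc]
      _ = (1 + y • u a) * (factorProd u y l * (1 + x • u a)) * factorProd u x l := by
          rw [hx, hy]
          simp only [mul_assoc]
          rw [ih'.eq, ← mul_assoc, ha, mul_assoc]
      _ = _ := by simp only [mul_assoc]

/-- The product telescopes from the inside, since `u i ^ 2 = 0` makes `1 + x u i` and `1 - x u i`
inverse. -/
theorem factorProd_mul_reverse (hsq : ∀ i, u i * u i = 0) (x : S) (l : List ι) :
    factorProd u x l * factorProd u (-x) l.reverse = 1 := by
  induction l with
  | nil => simp [factorProd]
  | cons a l ih =>
    have ha : (1 + x • u a) * (1 + (-x) • u a) = 1 := by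
      simp [mul_add, add_mul, hsq]
    simp only [factorProd, List.map_cons, List.prod_cons, List.reverse_cons, List.map_append,
      List.prod_append, List.map_nil, List.prod_nil, mul_one] at ih ⊢
    rw [← mul_assoc, mul_assoc (1 + x • u a), ih, mul_one, ha]

/-- The product along a list or along its reverse, depending on a sign. -/
def signedProd (u : ι → A) (l : List ι) (p : Bool × S) : A :=
  factorProd u p.2 (if p.1 then l else l.reverse)

/-- A product along the reversed list is the inverse of a product along the list with the opposite
sign, and inverses of commuting units commute. -/
theorem signedProd_commute (hsq : ∀ i, u i * u i = 0) (haba : ∀ i j, u i * u j * u i = 0)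
    {r : ι → ι → Prop}
    (hcomm : ∀ i m j, r i m → r m j → Commute (u m) (u j * u i - u i * u j))
    (l : List ι) (hl : l.Pairwise r) (p p' : Bool × S) :
    Commute (signedProd u l p) (signedProd u l p') := by
  let U : S → Aˣ := fun x => ⟨factorProd u x l, factorProd u (-x) l.reverse,
    factorProd_mul_reverse hsq x l, by
      simpa using factorProd_mul_reverse hsq (-x) l.reverse⟩
  have hU : ∀ x y, Commute (U x : A) (U y : A) :=
    fun x y => factorProd_commute hsq haba hcomm x y l hl
  have key : ∀ p : Bool × S, signedProd u l p = U p.2 ∨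
      signedProd u l p = ((U (-p.2))⁻¹ : Aˣ) := by
    rintro ⟨_ | _, x⟩
    · right
      simp [signedProd, U, Units.inv_mk]
    · left
      simp [signedProd, U]
  rcases key p with h | h <;> rcases key p' with h' | h' <;> rw [h, h']
  · exact hU _ _
  · exact (hU _ _).units_inv_right
  · exact (hU _ _).units_inv_left
  · exact ((hU _ _).units_inv_left).units_inv_right

end FactorProd

/-! ### Ribbon operators on bead configurations and their relations -/

section Beads

open Classical in
/-- The number of elements of `C` strictly between `i` and `i + n`. -/
noncomputable def beadsBetween (n : ℕ) (i : ℤ) (C : Set ℤ) : ℕ :=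
  ((Ioo i (i + n)).filter (· ∈ C)).card

/-- Move the bead at `i + n` to `i`. -/
def moveDown (n : ℕ) (i : ℤ) (C : Set ℤ) : Set ℤ := {t | t = i ∨ (t ∈ C ∧ t ≠ i + n)}

/-- A bead can be moved from `i + n` to `i`. -/
def CanMoveDown (n : ℕ) (i : ℤ) (C : Set ℤ) : Prop := i ∉ C ∧ i + n ∈ C

variable {S : Type*} [CommRing S]

open Classical in
/-- The operator that adds an `n`-ribbon whose smallest content is `i`. In terms of functions on
bead configurations, its value at `C` is read off from the configuration in which the ribbon
is removed. -/
noncomputable def addRibbon (n : ℕ) (q : S) (i : ℤ) : Module.End S (Set ℤ → S) where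
  toFun v C := if CanMoveDown n i C then q ^ beadsBetween n i C * v (moveDown n i C) else 0
  map_add' v w := by
    ext C; simp only [Pi.add_apply]; split_ifs <;> ring
  map_smul' c v := by
    ext C; simp only [Pi.smul_apply, smul_eq_mul, RingHom.id_apply]; split_ifs <;> ring

open Classical in
theorem addRibbon_apply (n : ℕ) (q : S) (i : ℤ) (v : Set ℤ → S) (C : Set ℤ) :
    addRibbon n q i v C =
      if CanMoveDown n i C then q ^ beadsBetween n i C * v (moveDown n i C) else 0 := rfl

variable {n : ℕ} {q : S}

theorem addRibbon_sq (i : ℤ) :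
    addRibbon n q i * addRibbon n q i = 0 := by
  ext v C
  simp only [Module.End.mul_apply, addRibbon_apply]
  have : ¬ CanMoveDown n i (moveDown n i C) := by simp [CanMoveDown, moveDown]
  simp [this]

/-- Two moves at `i` need both `i` and `i + n` to be reset in between; one move at `j` would have to
satisfy `j + n = i` and `j = i + n`. -/
theorem addRibbon_aba (hn : 1 ≤ n) (i j : ℤ) :
    addRibbon n q i * addRibbon n q j * addRibbon n q i = 0 := by
  ext v C
  simp only [Module.End.mul_apply, addRibbon_apply]
  have : ¬ CanMoveDown n i (moveDown n j (moveDown n i C)) := by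
    simp only [CanMoveDown, moveDown, Set.mem_ofPred_eq]
    grind
  simp [this]

theorem moveDown_comm {i j : ℤ} (h₁ : j ≠ i + n) (h₂ : i ≠ j + n) (C : Set ℤ) :
    moveDown n i (moveDown n j C) = moveDown n j (moveDown n i C) := by
  ext t
  simp only [moveDown, Set.mem_ofPred_eq]
  grind

theorem canMoveDown_moveDown {i j : ℤ} (h : i ≠ j) (h₁ : j ≠ i + n) (h₂ : i ≠ j + n) (C : Set ℤ) :
    CanMoveDown n i (moveDown n j C) ↔ CanMoveDown n i C := by
  simp only [CanMoveDown, moveDown, Set.mem_ofPred_eq]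
  grind

theorem beadsBetween_moveDown_far {i j : ℤ} (h : i + n < j ∨ j + n < i) (C : Set ℤ) :
    beadsBetween n i (moveDown n j C) = beadsBetween n i C := by
  unfold beadsBetween
  congr 1
  ext t
  simp only [moveDown, Set.mem_ofPred_eq, mem_filter, mem_Ioo]
  grind

theorem beadsBetween_moveDown_of_lt {i j : ℤ} (h : i < j) (h' : j < i + n) {C : Set ℤ}
    (hj : j ∉ C) : beadsBetween n i (moveDown n j C) = beadsBetween n i C + 1 := by
  classical
  unfold beadsBetween
  rw [← Finset.card_insert_of_notMem (a := j) (by simp [hj])]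
  congr 1
  ext t
  simp only [moveDown, Set.mem_ofPred_eq, mem_filter, mem_Ioo, mem_insert]
  grind

theorem beadsBetween_moveDown_of_gt {i j : ℤ} (h : i < j) (h' : j < i + n) {C : Set ℤ}
    (hi : i + n ∈ C) : beadsBetween n j C = beadsBetween n j (moveDown n i C) + 1 := by
  classical
  unfold beadsBetween
  rw [← Finset.card_insert_of_notMem (a := i + n)
    (s := (Ioo j (j + n)).filter (· ∈ moveDown n i C)) (by
      simp only [moveDown, Set.mem_ofPred_eq]; grind)]
  congr 1
  ext t
  simp only [moveDown, Set.mem_ofPred_eq, mem_filter, mem_Ioo, mem_insert]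
  grind

theorem addRibbon_commute_of_far {i j : ℤ} (h : i + n < j) :
    Commute (addRibbon n q i) (addRibbon n q j) := by
  have h₁ : j ≠ i + n := by omega
  have h₂ : i ≠ j + n := by omega
  ext v C
  simp only [Module.End.mul_apply, addRibbon_apply]
  rw [canMoveDown_moveDown (by omega) h₂ h₁, canMoveDown_moveDown (by omega) h₁ h₂,
    beadsBetween_moveDown_far (by omega), beadsBetween_moveDown_far (by omega),
    moveDown_comm h₁ h₂]
  split_ifs <;> ring

/-- The bead configuration reached is the same in both orders. As `i < j < i + n < j + n`, doing the
move at `j` first puts a bead into the interval of `i`, and doing the move at `i` first takes one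
out of the interval of `j`. Each contributes one factor `q`. -/
theorem addRibbon_q_commute {i j : ℤ} (h : i < j) (h' : j < i + n) :
    addRibbon n q j * addRibbon n q i = q ^ 2 • (addRibbon n q i * addRibbon n q j) := by
  have h₁ : j ≠ i + n := by omega
  have h₂ : i ≠ j + n := by omega
  ext v C
  simp only [Module.End.mul_apply, addRibbon_apply, LinearMap.smul_apply, Pi.smul_apply,
    smul_eq_mul]
  rw [canMoveDown_moveDown (by omega) h₂ h₁, canMoveDown_moveDown (by omega) h₁ h₂,
    moveDown_comm h₁ h₂]
  split_ifs with hj hi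
  · rw [beadsBetween_moveDown_of_lt h h' hj.1, beadsBetween_moveDown_of_gt h h' hi.2]
    ring
  all_goals simp

/-- If `j > i + n` the commutator is zero. Otherwise `m` is within distance `n` of both `i` and `j`,
and the powers of `q` from passing `u i` and `u j` cancel; this includes `j = i + n`, where `u i`
and `u j` themselves satisfy no such relation. -/
theorem addRibbon_commute_commutator_of_lt [IsDomain S] (hq : q ≠ 0) {i m j : ℤ} (h : i < m)
    (h' : m < j) : Commute (addRibbon n q m)
      (addRibbon n q j * addRibbon n q i - addRibbon n q i * addRibbon n q j) := by
  rcases lt_or_ge (i + n) j with hf | hf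
  · rw [(addRibbon_commute_of_far hf).eq, sub_self]
    exact Commute.zero_right _
  · have e₁ := addRibbon_q_commute (q := q) h (by omega : m < i + n)
    have e₂ := addRibbon_q_commute (q := q) h' (by omega : j < m + n)
    refine Commute.sub_right ?_ ?_
    -- Passing `u m` to the right of `u j` would cost `q⁻²`, so the identity is proved after
    -- multiplication by `q ^ 2`, which is then cancelled pointwise.
    · have key : q ^ 2 • (addRibbon n q m * (addRibbon n q j * addRibbon n q i)) =
          q ^ 2 • (addRibbon n q j * addRibbon n q i * addRibbon n q m) := by
        rw [← mul_assoc, ← smul_mul_assoc, ← e₂, mul_assoc, e₁, mul_smul_comm, mul_assoc]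
      ext v C
      have := congrFun (LinearMap.congr_fun key v) C
      simp only [LinearMap.smul_apply, Pi.smul_apply, smul_eq_mul] at this
      exact mul_left_cancel₀ (pow_ne_zero 2 hq) this
    · rw [Commute, SemiconjBy, ← mul_assoc, e₁, smul_mul_assoc, mul_assoc, ← mul_smul_comm, ← e₂,
        mul_assoc]

theorem addRibbon_commute_commutator [IsDomain S] (hq : q ≠ 0) {i m j : ℤ} (h : m < i)
    (h' : j < m) : Commute (addRibbon n q m)
      (addRibbon n q j * addRibbon n q i - addRibbon n q i * addRibbon n q j) := by
  rw [← neg_sub]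
  exact (addRibbon_commute_commutator_of_lt hq h' h).neg_right

end Beads

/-! ### Ribbons as lattice paths, one box per content -/

section Ribbons

/-- The content of a box. -/
def content (c : ℕ × ℕ) : ℤ := c.2 - c.1

/-- The smallest content of a box of `R`. -/
noncomputable def tail (R : Finset (ℕ × ℕ)) : ℤ := sInf (content '' (R : Set (ℕ × ℕ)))

/-- `R` is a lattice path of `n` boxes, with steps up and to the right, that starts at
content `t`. -/
structure IsPath (n : ℕ) (R : Finset (ℕ × ℕ)) (t : ℤ) : Prop where
  content_mem : ∀ c ∈ R, t ≤ content c ∧ content c < t + n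
  exists_mem : ∀ s, t ≤ s → s < t + n → ∃ c ∈ R, content c = s
  inj : ∀ c ∈ R, ∀ d ∈ R, content c = content d → c = d
  step : ∀ c ∈ R, ∀ d ∈ R, content d = content c + 1 →
    (d.1 = c.1 ∧ d.2 = c.2 + 1) ∨ (d.1 + 1 = c.1 ∧ d.2 = c.2)

theorem IsSkewShape.convex {R : Finset (ℕ × ℕ)} (h : IsSkewShape R) {a b c : ℕ × ℕ} (ha : a ∈ R)
    (hc : c ∈ R) (hab : a ≤ b) (hbc : b ≤ c) : b ∈ R := by
  obtain ⟨lam, mu, -, rfl⟩ := h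
  simp only [skewCells, mem_sdiff, YoungDiagram.mem_cells] at *
  exact ⟨lam.isLowerSet hbc hc.1, fun hb => ha.2 (mu.isLowerSet hab hb)⟩

theorem hasse_adj_content {c d : ℕ × ℕ} (h : (SimpleGraph.hasse (ℕ × ℕ)).Adj c d) :
    content d = content c + 1 ∨ content c = content d + 1 := by
  obtain ⟨a, b⟩ := c
  obtain ⟨a', b'⟩ := d
  simp only [SimpleGraph.hasse_adj, Prod.mk_covBy_mk_iff, Nat.covBy_iff_add_one_eq] at h
  simp only [content]
  omega

/-- Two boxes on one diagonal would, by convexity, force a `2 × 2` square. -/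
theorem IsRibbon.content_injOn {n : ℕ} {R : Finset (ℕ × ℕ)} (h : IsRibbon n R) {c d : ℕ × ℕ}
    (hc : c ∈ R) (hd : d ∈ R) (hcd : content c = content d) : c = d := by
  have key : ∀ a b k : ℕ, (a, b) ∈ R → (a + k + 1, b + k + 1) ∈ R → False := by
    intro a b k h₁ h₂
    refine h.no_square a b ⟨h₁, ?_, ?_, ?_⟩ <;>
    exact h.isSkewShape.convex h₁ h₂ (by simp) (by simp; try omega)
  obtain ⟨a, b⟩ := c
  obtain ⟨a', b'⟩ := d
  simp only [content] at hcd
  rcases lt_trichotomy a a' with hlt | heq | hlt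
  · obtain ⟨k, rfl⟩ := Nat.exists_eq_add_of_lt hlt
    obtain rfl : b' = b + k + 1 := by omega
    exact (key _ _ _ hc hd).elim
  · simp only [Prod.mk.injEq]; omega
  · obtain ⟨k, rfl⟩ := Nat.exists_eq_add_of_lt hlt
    obtain rfl : b = b' + k + 1 := by omega
    exact (key _ _ _ hd hc).elim

/-- A discrete intermediate value argument: content changes by one along each edge of a walk in the
ribbon. -/
theorem IsRibbon.exists_content {n : ℕ} {R : Finset (ℕ × ℕ)} (h : IsRibbon n R) {c d : ℕ × ℕ}
    (hc : c ∈ R) (hd : d ∈ R) {t : ℤ} (hct : content c ≤ t) (htd : t ≤ content d) :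
    ∃ e ∈ R, content e = t := by
  by_contra! hne
  have hc' : content c < t := lt_of_le_of_ne hct (hne c hc)
  obtain ⟨w⟩ := h.connected.preconnected ⟨c, hc⟩ ⟨d, hd⟩
  have key : ∀ {x y : (R : Set (ℕ × ℕ))},
      ((SimpleGraph.hasse (ℕ × ℕ)).induce (R : Set (ℕ × ℕ))).Walk x y →
        content x < t → content y < t := by
    intro x y w
    induction w with
    | nil => exact id
    | cons hadj _ ih =>
      intro hx
      refine ih ?_
      have h₁ := hasse_adj_content (SimpleGraph.induce_adj.1 hadj)
      rename_i v _ _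
      have h₂ := hne _ v.2
      omega
  have := key w hc'
  simp only at this
  omega

theorem IsRibbon.isPath_tail {n : ℕ} {R : Finset (ℕ × ℕ)} (h : IsRibbon n R) :
    IsPath n R (tail R) := by
  have hne : R.Nonempty := by
    obtain ⟨⟨c, hc⟩⟩ := h.connected.nonempty
    exact ⟨c, hc⟩
  obtain ⟨c, hc, hmin⟩ := R.exists_min_image content hne
  obtain ⟨d, hd, hmax⟩ := R.exists_max_image content hne
  have htail : tail R = content c := by
    refine IsLeast.csInf_eq ⟨⟨c, hc, rfl⟩, ?_⟩
    rintro _ ⟨e, he, rfl⟩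
    exact hmin e he
  have himage : R.image content = Icc (content c) (content d) := by
    ext t
    simp only [mem_image, mem_Icc]
    constructor
    · rintro ⟨e, he, rfl⟩
      exact ⟨hmin e he, hmax e he⟩
    · rintro ⟨h₁, h₂⟩
      exact h.exists_content hc hd h₁ h₂
  have hcard : content d + 1 = content c + n := by
    have h₁ := congrArg Finset.card himage
    rw [card_image_of_injOn (fun x hx y hy => h.content_injOn hx hy), h.card_eq,
      Int.card_Icc] at h₁
    have := hmin d hd
    omega
  rw [htail]
  refine ⟨fun e he => ⟨hmin e he, by have := hmax e he; omega⟩, fun s h₁ h₂ =>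
    h.exists_content hc hd h₁ (by omega), fun e he f hf => h.content_injOn he hf, ?_⟩
  rintro ⟨a, b⟩ he ⟨a', b'⟩ hf hef
  simp only [content] at hef ⊢
  -- If the step is not a unit step, convexity puts a diagonal neighbour of `(a, b)` into `R`,
  -- against injectivity of content.
  by_contra hcon
  rcases lt_or_ge a a' with hlt | hge
  · have h₁ : (a + 1, b + 1) ∈ R := h.isSkewShape.convex he hf (by simp)
      (by simp only [Prod.mk_le_mk]; omega)
    have := h.content_injOn he h₁ (by simp [content])
    simp at this
  · obtain ⟨a, rfl⟩ : ∃ k, a = k + 1 := ⟨a - 1, by omega⟩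
    obtain ⟨b, rfl⟩ : ∃ k, b = k + 1 := ⟨b - 1, by omega⟩
    have h₁ : (a, b) ∈ R := h.isSkewShape.convex hf he (by simp only [Prod.mk_le_mk]; omega)
      (by simp)
    have := h.content_injOn he h₁ (by simp [content])
    simp at this

end Ribbons

/-! ### Boundary profile of a diagram and its beads -/

section DiagRow

theorem exists_not_inside (lam : YoungDiagram) (t : ℤ) :
    ∃ m : ℕ, ¬ ∀ j : ℕ, (j : ℤ) = m + t → (m, j) ∈ lam := by
  -- This row lies below the whole diagram, and from row `-t` on the diagonal has a box with
  -- nonnegative column, so the condition is not vacuous.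
  refine ⟨max (lam.colLen 0) (-t).toNat, fun h => ?_⟩
  have h₁ := h (max (lam.colLen 0) (-t).toNat + t).toNat (by omega)
  have h₂ := YoungDiagram.mem_iff_lt_colLen.1
    (lam.up_left_mem le_rfl (Nat.zero_le _) h₁)
  omega

open Classical in
/-- The first row in which the diagonal of content `t` is outside the diagram `lam`. Boxes to the
left of the first column count as boxes of `lam`. -/
noncomputable def diagRow (lam : YoungDiagram) (t : ℤ) : ℕ := Nat.find (exists_not_inside lam t)

variable {lam nu : YoungDiagram}

theorem lt_diagRow {t : ℤ} {m : ℕ} :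
    m < diagRow lam t ↔ ∀ j : ℕ, (j : ℤ) = m + t → (m, j) ∈ lam := by
  classical
  unfold diagRow
  rw [Nat.lt_find_iff]
  constructor
  · intro h
    simpa using h m le_rfl
  · intro h k hk
    rw [not_not]
    intro j hj
    exact lam.up_left_mem hk (by omega) (h (j + (m - k)) (by omega))

theorem mem_iff_lt_diagRow {a b : ℕ} : (a, b) ∈ lam ↔ a < diagRow lam (content (a, b)) := by
  rw [lt_diagRow]
  simp only [content]
  constructor
  · intro h j hj
    obtain rfl : j = b := by omega
    exact h
  · exact fun h => h b (by omega)

theorem neg_le_diagRow (lam : YoungDiagram) (t : ℤ) : -t ≤ diagRow lam t := by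
  by_contra! h
  exact lt_irrefl _ (lt_diagRow.2 fun j (hj : (j : ℤ) = diagRow lam t + t) => by omega)

theorem diagRow_succ_le (lam : YoungDiagram) (t : ℤ) : diagRow lam (t + 1) ≤ diagRow lam t := by
  by_contra! h
  refine lt_irrefl _ (lt_diagRow.2 fun j (hj : (j : ℤ) = diagRow lam t + t) => ?_)
  exact lam.up_left_mem le_rfl (Nat.le_succ j) (lt_diagRow.1 h (j + 1) (by omega))

theorem diagRow_le_succ (lam : YoungDiagram) (t : ℤ) :
    diagRow lam t ≤ diagRow lam (t + 1) + 1 := by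
  by_contra! h
  refine lt_irrefl _ (lt_diagRow.2 fun j (hj : (j : ℤ) = diagRow lam (t + 1) + (t + 1)) => ?_)
  exact lam.up_left_mem (Nat.le_succ _) le_rfl (lt_diagRow.1 h j (by omega))

theorem diagRow_eq_zero {t : ℤ} (ht : (lam.rowLen 0 : ℤ) ≤ t) : diagRow lam t = 0 := by
  by_contra h
  have h₁ := YoungDiagram.mem_iff_lt_rowLen.1
    (lt_diagRow.1 (Nat.pos_of_ne_zero h) t.toNat (by omega))
  omega

theorem le_iff_diagRow : nu ≤ lam ↔ ∀ t, diagRow nu t ≤ diagRow lam t := by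
  constructor
  · intro h t
    by_contra! h'
    exact lt_irrefl _ (lt_diagRow.2 fun j hj => h (lt_diagRow.1 h' j hj))
  · rintro h ⟨a, b⟩ hab
    exact mem_iff_lt_diagRow.2 ((mem_iff_lt_diagRow.1 hab).trans_le (h _))

theorem eq_of_diagRow_eq (h : ∀ t, diagRow nu t = diagRow lam t) : nu = lam :=
  le_antisymm (le_iff_diagRow.2 fun t => (h t).le) (le_iff_diagRow.2 fun t => (h t).ge)

/-- The vertical steps of the boundary of `lam`, as positions of beads. -/
def beads (lam : YoungDiagram) : Set ℤ := {t | diagRow lam (t - 1) = diagRow lam t + 1}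

theorem mem_beads {t : ℤ} : t ∈ beads lam ↔ diagRow lam (t - 1) = diagRow lam t + 1 := Iff.rfl

theorem diagRow_of_notMem_beads {t : ℤ} (h : t ∉ beads lam) :
    diagRow lam (t - 1) = diagRow lam t := by
  have h₁ := diagRow_succ_le lam (t - 1)
  have h₂ := diagRow_le_succ lam (t - 1)
  rw [mem_beads] at h
  rw [sub_add_cancel] at h₁ h₂
  omega

/-- The profile is zero far to the right and drops by one exactly at the beads, so the beads
determine it by descending induction. -/
theorem beads_injective : Function.Injective beads := by
  intro nu lam h
  refine eq_of_diagRow_eq fun t => ?_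
  have key : ∀ (k : ℕ) (t : ℤ), (lam.rowLen 0 : ℤ) ≤ t + k → (nu.rowLen 0 : ℤ) ≤ t + k →
      diagRow nu t = diagRow lam t := by
    intro k
    induction k with
    | zero =>
      intro t h₁ h₂
      rw [diagRow_eq_zero (by simpa using h₂), diagRow_eq_zero (by simpa using h₁)]
    | succ k ih =>
      intro t h₁ h₂
      have ht := ih (t + 1) (by push_cast at h₁; linarith) (by push_cast at h₂; linarith)
      by_cases hb : t + 1 ∈ beads lam
      · have hb' := h ▸ hb
        rw [mem_beads, add_sub_cancel_right] at hb hb'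
        rw [hb, hb', ht]
      · have hb' := h ▸ hb
        have e := diagRow_of_notMem_beads hb
        have e' := diagRow_of_notMem_beads hb'
        rw [add_sub_cancel_right] at e e'
        rw [e, e', ht]
  exact key (max (lam.rowLen 0 - t).toNat (nu.rowLen 0 - t).toNat) t (by omega) (by omega)

end DiagRow

/-! ### Adding a ribbon is moving a bead -/

section RibbonStep

variable {n : ℕ} {i : ℤ} {lam nu : YoungDiagram}

/-- `lam` arises from `nu` by adding one box on each of the diagonals `i, …, i + n - 1`. -/
def IsRibbonStep (n : ℕ) (i : ℤ) (nu lam : YoungDiagram) : Prop :=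
  ∀ t, diagRow lam t = diagRow nu t + if i ≤ t ∧ t < i + n then 1 else 0

theorem mem_skewCells_iff {a b : ℕ} : (a, b) ∈ skewCells lam nu ↔
    diagRow nu (content (a, b)) ≤ a ∧ a < diagRow lam (content (a, b)) := by
  rw [skewCells, mem_sdiff, YoungDiagram.mem_cells, YoungDiagram.mem_cells, mem_iff_lt_diagRow,
    mem_iff_lt_diagRow, not_lt, and_comm]

theorem exists_mem_skewCells {t : ℤ} {m : ℕ} (h₁ : diagRow nu t ≤ m) (h₂ : m < diagRow lam t) :
    ∃ b : ℕ, (m, b) ∈ skewCells lam nu ∧ content (m, b) = t := by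
  have h₃ := neg_le_diagRow nu t
  have h₄ : content (m, (m + t).toNat) = t := by simp only [content]; omega
  exact ⟨(m + t).toNat, mem_skewCells_iff.2 (by rw [h₄]; exact ⟨h₁, h₂⟩), h₄⟩

theorem IsPath.isRibbonStep (hle : nu ≤ lam) (h : IsPath n (skewCells lam nu) i) :
    IsRibbonStep n i nu lam := by
  intro t
  have hmono := le_iff_diagRow.1 hle t
  split_ifs with ht
  · obtain ⟨⟨a, b⟩, hc, rfl⟩ := h.exists_mem t ht.1 ht.2
    rw [mem_skewCells_iff] at hc
    by_contra hne
    obtain ⟨b₁, hb₁, e₁⟩ := exists_mem_skewCells (nu := nu) (lam := lam)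
      (t := content (a, b)) le_rfl (by omega)
    obtain ⟨b₂, hb₂, e₂⟩ := exists_mem_skewCells (nu := nu) (lam := lam)
      (t := content (a, b)) (Nat.le_succ _) (by omega)
    have := h.inj _ hb₁ _ hb₂ (e₁.trans e₂.symm)
    simp at this
  · by_contra hne
    obtain ⟨b, hb, hbt⟩ := exists_mem_skewCells (nu := nu) (lam := lam) (t := t) le_rfl (by omega)
    exact ht (hbt ▸ h.content_mem _ hb)

namespace IsRibbonStep

theorem le (h : IsRibbonStep n i nu lam) : nu ≤ lam :=
  le_iff_diagRow.2 fun t => by rw [h t]; exact Nat.le_add_right _ _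

theorem eq_left {nu' : YoungDiagram} (h : IsRibbonStep n i nu lam)
    (h' : IsRibbonStep n i nu' lam) : nu = nu' :=
  eq_of_diagRow_eq fun t => Nat.add_right_cancel ((h t).symm.trans (h' t))

theorem mem_skewCells (h : IsRibbonStep n i nu lam) {a b : ℕ} : (a, b) ∈ skewCells lam nu ↔
    a = diagRow nu (content (a, b)) ∧ i ≤ content (a, b) ∧ content (a, b) < i + n := by
  rw [mem_skewCells_iff, h]
  split_ifs <;> omega

theorem content_injOn (h : IsRibbonStep n i nu lam) {c d : ℕ × ℕ} (hc : c ∈ skewCells lam nu)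
    (hd : d ∈ skewCells lam nu) (hcd : content c = content d) : c = d := by
  obtain ⟨a, b⟩ := c
  obtain ⟨a', b'⟩ := d
  rw [h.mem_skewCells] at hc hd
  rw [hcd] at hc
  simp only [content, Prod.mk.injEq] at *
  omega

theorem exists_content (h : IsRibbonStep n i nu lam) {t : ℤ} (h₁ : i ≤ t) (h₂ : t < i + n) :
    ∃ c ∈ skewCells lam nu, content c = t := by
  obtain ⟨b, hb, hbt⟩ := exists_mem_skewCells (nu := nu) (lam := lam) (t := t) le_rfl (by
    rw [h, if_pos ⟨h₁, h₂⟩]; omega)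
  exact ⟨_, hb, hbt⟩

theorem connected (hn : 1 ≤ n) (h : IsRibbonStep n i nu lam) :
    ((SimpleGraph.hasse (ℕ × ℕ)).induce (skewCells lam nu : Set (ℕ × ℕ))).Connected := by
  rw [SimpleGraph.connected_iff_exists_forall_reachable]
  obtain ⟨v, hv, hvi⟩ := h.exists_content le_rfl (by omega : i < i + n)
  refine ⟨⟨v, hv⟩, ?_⟩
  have key : ∀ (k : ℕ) (w : (skewCells lam nu : Set (ℕ × ℕ))), content w = i + k →
      ((SimpleGraph.hasse (ℕ × ℕ)).induce (skewCells lam nu : Set (ℕ × ℕ))).Reachable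
        ⟨v, hv⟩ w := by
    intro k
    induction k with
    | zero =>
      rintro ⟨w, hw⟩ hwi
      obtain rfl := h.content_injOn hv hw (by simp_all)
      exact SimpleGraph.Reachable.refl _
    | succ k ih =>
      rintro ⟨⟨a, b⟩, hw⟩ hwi
      have hw' := h.mem_skewCells.1 hw
      simp only at hwi
      obtain ⟨⟨a', b'⟩, hc, hci⟩ := h.exists_content (by omega : i ≤ i + k) (by omega)
      refine (ih ⟨_, hc⟩ hci).trans (SimpleGraph.Adj.reachable ?_)
      have hc' := h.mem_skewCells.1 hc
      have e₁ := diagRow_succ_le nu (i + k)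
      have e₂ := diagRow_le_succ nu (i + k)
      rw [hci] at hc'
      rw [show content (a, b) = i + k + 1 by omega] at hw'
      rw [SimpleGraph.comap_adj]
      simp only [content, Function.Embedding.subtype_apply, SimpleGraph.hasse_adj,
        Prod.mk_covBy_mk_iff, Nat.covBy_iff_add_one_eq] at hci hwi ⊢
      omega
  rintro ⟨w, hw⟩
  have hw' := (h.mem_skewCells (a := w.1) (b := w.2)).1 hw
  exact key (content w - i).toNat ⟨w, hw⟩ (by simp only [Prod.mk.eta] at *; omega)

theorem image_content (h : IsRibbonStep n i nu lam) :
    (skewCells lam nu).image content = Ico i (i + n) := by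
  ext t
  simp only [mem_image, mem_Ico]
  constructor
  · rintro ⟨⟨a, b⟩, hc, rfl⟩
    exact (h.mem_skewCells.1 hc).2
  · exact fun ht => h.exists_content ht.1 ht.2

theorem isRibbon (hn : 1 ≤ n) (h : IsRibbonStep n i nu lam) : IsRibbon n (skewCells lam nu) where
  isSkewShape := ⟨lam, nu, h.le, rfl⟩
  card_eq := by
    rw [← card_image_of_injOn (fun c hc d hd => h.content_injOn hc hd), h.image_content]
    simp
  connected := h.connected hn
  no_square a b := by
    rintro ⟨h₁, -, -, h₂⟩
    have := h.content_injOn h₁ h₂ (by simp [content])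
    simp at this

theorem tail_eq (hn : 1 ≤ n) (h : IsRibbonStep n i nu lam) : tail (skewCells lam nu) = i := by
  refine IsLeast.csInf_eq ⟨?_, ?_⟩
  · obtain ⟨c, hc, hct⟩ := h.exists_content le_rfl (by omega)
    exact ⟨c, hc, hct⟩
  · rintro _ ⟨⟨a, b⟩, hc, rfl⟩
    exact (h.mem_skewCells.1 hc).2.1

/-- Raising the profile on `i, …, i + n - 1` changes its drops only at `i`, where one is lost, and
at `i + n`, where one is gained. Drops are always 0 or 1. -/
theorem canMoveDown_beads (hn : 1 ≤ n) (h : IsRibbonStep n i nu lam) :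
    CanMoveDown n i (beads lam) := by
  constructor
  · rw [mem_beads, h, h, if_neg (by omega), if_pos (by omega)]
    have := diagRow_le_succ nu (i - 1)
    rw [sub_add_cancel] at this
    omega
  · rw [mem_beads, h, h, if_pos (by omega), if_neg (by omega)]
    have h₁ := diagRow_succ_le nu (i + n - 1)
    have h₂ := diagRow_succ_le lam (i + n - 1)
    have h₃ := diagRow_le_succ lam (i + n - 1)
    rw [h, h, if_pos (by omega), if_neg (by omega)] at h₃
    rw [sub_add_cancel] at h₁ h₃
    omega

theorem moveDown_beads (hn : 1 ≤ n) (h : IsRibbonStep n i nu lam) :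
    moveDown n i (beads lam) = beads nu := by
  have h₀ := h.canMoveDown_beads hn
  rw [CanMoveDown, mem_beads, mem_beads] at h₀
  ext t
  simp only [moveDown, Set.mem_ofPred_eq, mem_beads]
  have h₁ := h (t - 1)
  have h₂ := h t
  by_cases hi : t = i
  · subst hi
    have h₃ := diagRow_le_succ lam (t - 1)
    have h₄ := diagRow_succ_le lam (t - 1)
    rw [if_neg (by omega)] at h₁
    rw [if_pos (by omega)] at h₂
    rw [sub_add_cancel] at h₃ h₄
    simp only [true_or, true_iff]
    omega
  · by_cases hi' : t = i + n
    · subst hi'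
      rw [if_pos (by omega)] at h₁
      rw [if_neg (by omega)] at h₂
      simp only [hi, ne_eq, not_true, and_false, or_self, false_iff]
      omega
    · simp only [hi, hi', false_or, ne_eq, not_false_iff, and_true]
      split_ifs at h₁ h₂ <;> omega

end IsRibbonStep

open Classical in
-- The profile is weakly decreasing, so it takes one more value than it has drops, and the drops are
-- the beads.
theorem card_image_diagRow (lam : YoungDiagram) (i : ℤ) (k : ℕ) :
    ((Ico i (i + k + 1)).image (diagRow lam)).card =
      ((Ioo i (i + k + 1)).filter (· ∈ beads lam)).card + 1 := by
  have hmono : ∀ (k : ℕ) (t : ℤ), i ≤ t → t < i + k + 1 → diagRow lam (i + k) ≤ diagRow lam t := by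
    intro k
    induction k with
    | zero =>
      intro t h₁ h₂
      obtain rfl : t = i := by push_cast at h₂; omega
      simp
    | succ k ih =>
      intro t h₁ h₂
      push_cast at h₂ ⊢
      rcases eq_or_lt_of_le (show t ≤ i + (k + 1) by omega) with rfl | hlt
      · exact le_rfl
      · rw [← add_assoc]
        exact (diagRow_succ_le lam _).trans (ih t h₁ (by omega))
  induction k with
  | zero =>
    have e₁ : Ico i (i + (0 : ℕ) + 1) = {i} := by ext; simp; omega
    have e₂ : Ioo i (i + (0 : ℕ) + 1) = ∅ := by ext; simp
    rw [e₁, e₂]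
    simp
  | succ k ih =>
    have e₁ : Ico i (i + (k + 1 : ℕ) + 1) = insert (i + k + 1) (Ico i (i + k + 1)) := by
      ext; simp; omega
    have e₂ : Ioo i (i + (k + 1 : ℕ) + 1) = insert (i + k + 1) (Ioo i (i + k + 1)) := by
      ext; simp; omega
    rw [e₁, e₂, image_insert, filter_insert]
    split_ifs with hb
    · rw [card_insert_of_notMem (s := filter _ _) (by simp), card_insert_of_notMem, ih]
      rw [mem_image]
      rintro ⟨t, ht, hte⟩
      rw [mem_Ico] at ht
      have h₁ := hmono k t ht.1 ht.2
      rw [mem_beads, add_sub_cancel_right] at hb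
      omega
    · have h₁ := diagRow_of_notMem_beads hb
      rw [add_sub_cancel_right] at h₁
      rw [insert_eq_of_mem, ih]
      exact mem_image.2 ⟨i + k, by simp, h₁⟩

/-- The box of the ribbon on diagonal `t` lies in row `diagRow nu t`, and `nu` and `lam` have the
same beads strictly between `i` and `i + n`. -/
theorem IsRibbonStep.spin_eq (hn : 1 ≤ n) (h : IsRibbonStep n i nu lam) :
    spin (skewCells lam nu) = beadsBetween n i (beads lam) := by
  classical
  have himage : (skewCells lam nu).image Prod.fst = (Ico i (i + n)).image (diagRow nu) := by
    rw [← h.image_content, image_image]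
    refine image_congr fun c hc => ?_
    exact ((h.mem_skewCells (a := c.1) (b := c.2)).1 hc).1
  obtain ⟨k, rfl⟩ : ∃ k, n = k + 1 := ⟨n - 1, by omega⟩
  have hk := card_image_diagRow nu i k
  rw [spin, himage, beadsBetween]
  push_cast
  rw [← add_assoc, hk, Nat.add_sub_cancel]
  congr 1
  refine filter_congr fun t ht => ?_
  rw [← h.moveDown_beads hn]
  rw [mem_Ioo] at ht
  simp only [moveDown, Set.mem_ofPred_eq]
  push_cast
  constructor
  · rintro (rfl | h') <;> [omega; exact h'.1]
  · exact fun h' => Or.inr ⟨h', by omega⟩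

theorem isLowerSet_of_pred {D : Finset (ℕ × ℕ)} (h₁ : ∀ a b, (a + 1, b) ∈ D → (a, b) ∈ D)
    (h₂ : ∀ a b, (a, b + 1) ∈ D → (a, b) ∈ D) : IsLowerSet (D : Set (ℕ × ℕ)) := by
  have h₁' : ∀ a b k, (a + k, b) ∈ D → (a, b) ∈ D := by
    intro a b k
    induction k with
    | zero => exact id
    | succ k ih => exact fun h => ih (h₁ _ _ h)
  have h₂' : ∀ a b k, (a, b + k) ∈ D → (a, b) ∈ D := by
    intro a b k
    induction k with
    | zero => exact id
    | succ k ih => exact fun h => ih (h₂ _ _ h)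
  rintro ⟨a, b⟩ ⟨a', b'⟩ ⟨ha, hb⟩ hab
  obtain ⟨k, rfl⟩ := Nat.exists_eq_add_of_le ha
  obtain ⟨l, rfl⟩ := Nat.exists_eq_add_of_le hb
  exact h₁' _ _ _ (h₂' _ _ _ hab)

theorem exists_isRibbonStep (hn : 1 ≤ n) (h : CanMoveDown n i (beads lam)) :
    ∃ nu, IsRibbonStep n i nu lam := by
  obtain ⟨hi, hin⟩ := h
  have hi' := diagRow_of_notMem_beads hi
  rw [mem_beads] at hi hin
  -- The smaller diagram is obtained by deleting the last box on each of the diagonals `i, …, i + n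
  -- - 1`.
  let D := lam.cells.filter fun c => ¬ (i ≤ content c ∧ content c < i + n ∧
    c.1 + 1 = diagRow lam (content c))
  have hD : ∀ a b, (a, b) ∈ D ↔ a < diagRow lam (content (a, b)) ∧
      ¬ (i ≤ content (a, b) ∧ content (a, b) < i + n ∧
        a + 1 = diagRow lam (content (a, b))) := by
    intro a b
    rw [mem_filter, YoungDiagram.mem_cells, mem_iff_lt_diagRow]
  have hlow : IsLowerSet (D : Set (ℕ × ℕ)) := by
    refine isLowerSet_of_pred ?_ ?_
    · intro a b hab
      rw [hD] at hab ⊢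
      have hc : content (a, b) = content (a + 1, b) + 1 := by simp [content]; ring
      have e₁ := diagRow_succ_le lam (content (a + 1, b))
      have e₂ := diagRow_le_succ lam (content (a + 1, b))
      rw [hc]
      refine ⟨by omega, fun h => hab.2 ?_⟩
      -- Deleting the last boxes can break the lower set property only at the two ends of the range
      -- of diagonals. Here `i` not being a bead prevents it; at the other end `i + n` being a bead
      -- does.
      have hne : content (a + 1, b) + 1 ≠ i := by
        intro hne
        rw [hne] at e₁ e₂ h
        rw [← hne, add_sub_cancel_right] at hi'
        rw [hne] at hi'
        omega
      omega
    · intro a b hab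
      rw [hD] at hab ⊢
      have hc : content (a, b + 1) = content (a, b) + 1 := by simp [content]; ring
      rw [hc] at hab
      have e₁ := diagRow_succ_le lam (content (a, b))
      have e₂ := diagRow_le_succ lam (content (a, b))
      refine ⟨by omega, fun h => hab.2 ?_⟩
      have hne : content (a, b) + 1 ≠ i + n := by
        intro hne
        rw [← hne, add_sub_cancel_right] at hin
        omega
      omega
  refine ⟨⟨D, hlow⟩, fun t => ?_⟩
  have hlt : ∀ m : ℕ, m < diagRow ⟨D, hlow⟩ t ↔ (m : ℤ) + t < 0 ∨ (m < diagRow lam t ∧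
      ¬ (i ≤ t ∧ t < i + n ∧ m + 1 = diagRow lam t)) := by
    intro m
    rw [lt_diagRow]
    rcases lt_or_ge ((m : ℤ) + t) 0 with hneg | hpos
    · simp only [hneg, true_or, iff_true]
      intro j hj
      omega
    · have hc : content (m, (m + t).toNat) = t := by simp only [content]; omega
      have hDm := hD m (m + t).toNat
      rw [hc] at hDm
      rw [← hDm]
      constructor
      · exact fun h => Or.inr (h _ (by omega))
      · rintro (h | h) j hj
        · omega
        · obtain rfl : j = (m + t).toNat := by omega
          exact h
  have hge := neg_le_diagRow lam t
  -- Each affected diagonal really has a box to delete: positivity spreads leftwards from the drop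
  -- at `i + n`, and the bound `-t + 1` spreads rightwards from the missing drop at `i`.
  have hbound : i ≤ t → t < i + n → 1 ≤ diagRow lam t ∧ -t + 1 ≤ diagRow lam t := by
    intro h₁ h₂
    constructor
    · have key : ∀ k : ℕ, 1 ≤ diagRow lam (i + n - 1 - k) := by
        intro k
        induction k with
        | zero => simp [hin]
        | succ k ih =>
          have := diagRow_succ_le lam (i + n - 1 - (k + 1 : ℕ))
          rw [show i + n - 1 - (k + 1 : ℕ) + 1 = i + n - 1 - k by push_cast; ring] at this
          omega
      have := key (i + n - 1 - t).toNat
      rwa [show i + n - 1 - ((i + n - 1 - t).toNat : ℤ) = t by omega] at this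
    · have key : ∀ k : ℕ, -(i + k) + 1 ≤ diagRow lam (i + k) := by
        intro k
        induction k with
        | zero =>
          have := neg_le_diagRow lam (i - 1)
          rw [hi'] at this
          simp
          omega
        | succ k ih =>
          have := diagRow_le_succ lam (i + k)
          push_cast
          rw [← add_assoc]
          omega
      have := key (t - i).toNat
      rwa [show i + ((t - i).toNat : ℤ) = t by omega] at this
  have hA := hlt (diagRow ⟨D, hlow⟩ t)
  have hB := hlt (diagRow lam t - 1)
  have hC := hlt (diagRow lam t - 2)
  have hE := hlt (diagRow lam t)
  split_ifs with ht
  · have := hbound ht.1 ht.2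
    omega
  · omega

end RibbonStep

/-! ### Relative position of ribbons in a strip -/

section Strips

variable {n : ℕ} {R R' : Finset (ℕ × ℕ)} {t t' : ℤ}

theorem IsPath.mono (h : IsPath n R t) {c d : ℕ × ℕ} (hc : c ∈ R) (hd : d ∈ R)
    (hcd : content c ≤ content d) : d.1 ≤ c.1 ∧ c.2 ≤ d.2 := by
  have key : ∀ (k : ℕ) (c d : ℕ × ℕ), c ∈ R → d ∈ R → content d = content c + k →
      d.1 ≤ c.1 ∧ c.2 ≤ d.2 := by
    intro k
    induction k with
    | zero =>
      intro c d hc hd hcd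
      obtain rfl := h.inj c hc d hd (by simp [hcd])
      exact ⟨le_rfl, le_rfl⟩
    | succ k ih =>
      intro c d hc hd hcd
      have h₁ := h.content_mem c hc
      have h₂ := h.content_mem d hd
      obtain ⟨e, he, hec⟩ := h.exists_mem (content c + k) (by omega) (by omega)
      have h₃ := ih c e hc he hec
      have h₄ := h.step e he d hd (by push_cast at hcd; omega)
      omega
  exact key (content d - content c).toNat c d hc hd (by omega)

theorem IsPath.isTopRight_iff (hn : 1 ≤ n) (h : IsPath n R t) {c : ℕ × ℕ} :
    IsTopRight R c ↔ c ∈ R ∧ content c = t + n - 1 := by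
  constructor
  · rintro ⟨hc, hmax⟩
    obtain ⟨d, hd, hdt⟩ := h.exists_mem (t + n - 1) (by omega) (by omega)
    have h₁ := hmax d hd
    have h₂ := h.content_mem c hc
    refine ⟨hc, ?_⟩
    simp only [content] at *
    omega
  · rintro ⟨hc, hct⟩
    refine ⟨hc, fun d hd => h.mono hd hc ?_⟩
    have := h.content_mem d hd
    omega

theorem IsPath.isBottomLeft_iff (hn : 1 ≤ n) (h : IsPath n R t) {c : ℕ × ℕ} :
    IsBottomLeft R c ↔ c ∈ R ∧ content c = t := by
  constructor
  · rintro ⟨hc, hmin⟩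
    obtain ⟨d, hd, hdt⟩ := h.exists_mem t le_rfl (by omega)
    have h₁ := hmin d hd
    have h₂ := h.content_mem c hc
    refine ⟨hc, ?_⟩
    simp only [content] at *
    omega
  · rintro ⟨hc, hct⟩
    refine ⟨hc, fun d hd => h.mono hc hd ?_⟩
    have := h.content_mem d hd
    omega

theorem isHorizontalStrip_iff (hn : 1 ≤ n) {P : Finset (Finset (ℕ × ℕ))}
    (hP : ∀ R ∈ P, IsRibbon n R) : IsHorizontalStrip P ↔ ∀ R ∈ P, ∀ R' ∈ P, ∀ a b : ℕ,
      (a + 1, b) ∈ R → content (a + 1, b) = tail R + n - 1 → (a, b) ∉ R' := by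
  constructor
  · intro h R hR R' hR' a b hab hc hab'
    have hp := (hP R hR).isPath_tail
    obtain ⟨c, hcR, hcN⟩ := h R hR
    rw [hp.isTopRight_iff hn] at hcR
    obtain rfl := hp.inj _ hab c hcR.1 (hc.trans hcR.2.symm)
    exact hcN a rfl (mem_sup.2 ⟨R', hR', hab'⟩)
  · intro h R hR
    have hp := (hP R hR).isPath_tail
    obtain ⟨c, hcR, hct⟩ := hp.exists_mem (tail R + n - 1) (by omega) (by omega)
    refine ⟨c, (hp.isTopRight_iff hn).2 ⟨hcR, hct⟩, fun i hi hmem => ?_⟩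
    obtain ⟨R', hR', hiR'⟩ := mem_sup.1 hmem
    obtain ⟨a, b⟩ := c
    subst hi
    exact h R hR R' hR' i b hcR hct hiR'

theorem isVerticalStrip_iff (hn : 1 ≤ n) {P : Finset (Finset (ℕ × ℕ))}
    (hP : ∀ R ∈ P, IsRibbon n R) : IsVerticalStrip P ↔ ∀ R ∈ P, ∀ R' ∈ P, ∀ a b : ℕ,
      (a, b + 1) ∈ R → content (a, b + 1) = tail R → (a, b) ∉ R' := by
  constructor
  · intro h R hR R' hR' a b hab hc hab'
    have hp := (hP R hR).isPath_tail
    obtain ⟨c, hcR, hcN⟩ := h R hR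
    rw [hp.isBottomLeft_iff hn] at hcR
    obtain rfl := hp.inj _ hab c hcR.1 (hc.trans hcR.2.symm)
    exact hcN b rfl (mem_sup.2 ⟨R', hR', hab'⟩)
  · intro h R hR
    have hp := (hP R hR).isPath_tail
    obtain ⟨c, hcR, hct⟩ := hp.exists_mem (tail R) (by omega) (by omega)
    refine ⟨c, (hp.isBottomLeft_iff hn).2 ⟨hcR, hct⟩, fun i hi hmem => ?_⟩
    obtain ⟨R', hR', hiR'⟩ := mem_sup.1 hmem
    obtain ⟨a, b⟩ := c
    subst hi
    exact h R hR R' hR' a i hcR hct hiR'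

/-- In a horizontal strip, a path with larger head content is not northwest of another one. -/
theorem IsPath.not_northwest_of_north (h : IsPath n R t) (h' : IsPath n R' t') (htt : t' ≤ t)
    (hdisj : Disjoint R R') {S : Set (ℕ × ℕ)} (hS : S.OrdConnected) (hRS : ∀ c ∈ R, c ∈ S)
    (hRS' : ∀ c ∈ R', c ∈ S)
    (hN : ∀ a b : ℕ, (a + 1, b) ∈ R' → content (a + 1, b) = t' + n - 1 → (a, b) ∉ S)
    {c c' : ℕ × ℕ} (hc : c ∈ R) (hc' : c' ∈ R') (hcc : content c = content c') :
    ¬ c.1 < c'.1 := by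
  -- Induction on the distance `k` to the head of `R'`. Disjoint paths never meet on a diagonal, so
  -- stepping along both keeps `R` northwest; at the head, the box directly above lies between boxes
  -- of `S`, hence in `S`.
  have key : ∀ (k : ℕ) (c c' : ℕ × ℕ), c ∈ R → c' ∈ R' → content c = content c' → c.1 < c'.1 →
      content c' + k = t' + n - 1 → False := by
    intro k
    induction k with
    | zero =>
      rintro ⟨a, b⟩ ⟨a', b'⟩ hc hc' hcc hlt hk
      obtain ⟨m, rfl⟩ : ∃ m, a' = m + 1 := ⟨a' - 1, by simp only at hlt; omega⟩
      refine hN m b' hc' (by simpa using hk) (hS.out (hRS _ hc) (hRS' _ hc') ⟨?_, ?_⟩)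
      · simp only [content, Prod.mk_le_mk] at *
        omega
      · simp
    | succ k ih =>
      intro c c' hc hc' hcc hlt hk
      have h₁ := h.content_mem c hc
      have h₂ := h'.content_mem c' hc'
      push_cast at hk
      obtain ⟨d, hd, hdc⟩ := h.exists_mem (content c + 1) (by omega) (by omega)
      obtain ⟨d', hd', hdc'⟩ := h'.exists_mem (content c' + 1) (by omega) (by omega)
      refine ih d d' hd hd' (by omega) ?_ (by omega)
      have h₃ := h.step c hc d hd hdc
      have h₄ := h'.step c' hc' d' hd' hdc'
      have h₅ : d ≠ d' := fun e => disjoint_left.1 hdisj hd (e ▸ hd')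
      have h₆ : d.1 ≠ d'.1 := by
        intro e
        refine h₅ (Prod.ext e ?_)
        simp only [content] at *
        omega
      omega
  intro hlt
  have := h'.content_mem c' hc'
  exact key (t' + n - 1 - content c').toNat c c' hc hc' hcc hlt (by omega)

/-- In a vertical strip, a path with smaller tail content is not northwest of another one. -/
theorem IsPath.not_northwest_of_west (h : IsPath n R t) (h' : IsPath n R' t') (htt : t ≤ t')
    (hdisj : Disjoint R R') {S : Set (ℕ × ℕ)} (hS : S.OrdConnected) (hRS : ∀ c ∈ R, c ∈ S)
    (hRS' : ∀ c ∈ R', c ∈ S)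
    (hW : ∀ a b : ℕ, (a, b + 1) ∈ R' → content (a, b + 1) = t' → (a, b) ∉ S)
    {c c' : ℕ × ℕ} (hc : c ∈ R) (hc' : c' ∈ R') (hcc : content c = content c') :
    ¬ c.1 < c'.1 := by
  -- The same induction run towards the tail of `R'`, where the box directly to the left is forced
  -- into `S`.
  have key : ∀ (k : ℕ) (c c' : ℕ × ℕ), c ∈ R → c' ∈ R' → content c = content c' → c.1 < c'.1 →
      content c' = t' + k → False := by
    intro k
    induction k with
    | zero =>
      rintro ⟨a, b⟩ ⟨a', b'⟩ hc hc' hcc hlt hk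
      obtain ⟨m, rfl⟩ : ∃ m, b' = m + 1 := ⟨b' - 1, by simp only [content] at hlt hcc; omega⟩
      refine hW a' m hc' (by simpa using hk) (hS.out (hRS _ hc) (hRS' _ hc') ⟨?_, ?_⟩)
      · simp only [content, Prod.mk_le_mk] at *
        omega
      · simp
    | succ k ih =>
      intro c c' hc hc' hcc hlt hk
      have h₁ := h.content_mem c hc
      have h₂ := h'.content_mem c' hc'
      push_cast at hk
      obtain ⟨d, hd, hdc⟩ := h.exists_mem (content c - 1) (by omega) (by omega)
      obtain ⟨d', hd', hdc'⟩ := h'.exists_mem (content c' - 1) (by omega) (by omega)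
      refine ih d d' hd hd' (by omega) ?_ (by omega)
      have h₃ := h.step d hd c hc (by omega)
      have h₄ := h'.step d' hd' c' hc' (by omega)
      have h₅ : d ≠ d' := fun e => disjoint_left.1 hdisj hd (e ▸ hd')
      have h₆ : d.1 ≠ d'.1 := by
        intro e
        refine h₅ (Prod.ext e ?_)
        simp only [content] at *
        omega
      omega
  intro hlt
  have := h'.content_mem c' hc'
  exact key (content c' - t').toNat c c' hc hc' hcc hlt (by omega)

/-- If a box of `R'` followed a box of `R`, then one more step along `R` or `R'` would put `R`
northwest of `R'` on a common diagonal; if no such step is left, that box is the head of `R'` and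
does not touch the northern boundary. This makes the ribbon of larger content removable first. -/
theorem IsPath.not_succ_of_north (h : IsPath n R t) (h' : IsPath n R' t') (htt : t' ≤ t)
    (hdisj : Disjoint R R') {S : Set (ℕ × ℕ)} (hS : S.OrdConnected) (hRS : ∀ c ∈ R, c ∈ S)
    (hRS' : ∀ c ∈ R', c ∈ S)
    (hN : ∀ a b : ℕ, (a + 1, b) ∈ R' → content (a + 1, b) = t' + n - 1 → (a, b) ∉ S)
    {a b : ℕ} (hc : (a, b) ∈ R) : (a + 1, b) ∉ R' ∧ (a, b + 1) ∉ R' := by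
  have hnw := fun c c' => h.not_northwest_of_north h' htt hdisj hS hRS hRS' hN (c := c) (c' := c')
  have hne : ∀ x ∈ R, ∀ y ∈ R', x ≠ y := fun x hx y hy e => disjoint_left.1 hdisj hx (e ▸ hy)
  have h₁ := h.content_mem _ hc
  constructor
  · intro hc'
    have h₂ := h'.content_mem _ hc'
    have hcont : content (a, b) = content (a + 1, b) + 1 := by simp [content]; ring
    rcases eq_or_ne (content (a + 1, b)) (t' + n - 1) with e | e
    · exact hN a b hc' e (hRS _ hc)
    · obtain ⟨d, hd, hdc⟩ := h'.exists_mem (content (a, b)) (by omega) (by omega)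
      have h₃ := h'.step _ hc' d hd (by omega)
      have h₄ := hne _ hc _ hd
      refine hnw _ _ hc hd hdc.symm ?_
      rcases h₃ with h₃ | h₃
      · simp only at h₃ ⊢; omega
      · exact (h₄ (Prod.ext (by simp only at h₃ ⊢; omega) (by simp only at h₃ ⊢; omega))).elim
  · intro hc'
    have h₂ := h'.content_mem _ hc'
    have hcont : content (a, b + 1) = content (a, b) + 1 := by simp [content]; ring
    obtain ⟨d, hd, hdc⟩ := h.exists_mem (content (a, b + 1)) (by omega) (by omega)
    have h₃ := h.step _ hc d hd (by omega)
    have h₄ := hne _ hd _ hc'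
    refine hnw _ _ hd hc' hdc ?_
    rcases h₃ with h₃ | h₃
    · exact (h₄ (Prod.ext h₃.1 h₃.2)).elim
    · simp only at h₃ ⊢; omega

theorem IsPath.not_succ_of_west (h : IsPath n R t) (h' : IsPath n R' t') (htt : t ≤ t')
    (hdisj : Disjoint R R') {S : Set (ℕ × ℕ)} (hS : S.OrdConnected) (hRS : ∀ c ∈ R, c ∈ S)
    (hRS' : ∀ c ∈ R', c ∈ S)
    (hW : ∀ a b : ℕ, (a, b + 1) ∈ R' → content (a, b + 1) = t' → (a, b) ∉ S)
    {a b : ℕ} (hc : (a, b) ∈ R) : (a + 1, b) ∉ R' ∧ (a, b + 1) ∉ R' := by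
  have hnw := fun c c' => h.not_northwest_of_west h' htt hdisj hS hRS hRS' hW (c := c) (c' := c')
  have hne : ∀ x ∈ R, ∀ y ∈ R', x ≠ y := fun x hx y hy e => disjoint_left.1 hdisj hx (e ▸ hy)
  have h₁ := h.content_mem _ hc
  constructor
  · intro hc'
    have h₂ := h'.content_mem _ hc'
    have hcont : content (a, b) = content (a + 1, b) + 1 := by simp [content]; ring
    obtain ⟨d, hd, hdc⟩ := h.exists_mem (content (a + 1, b)) (by omega) (by omega)
    have h₃ := h.step d hd _ hc (by omega)
    have h₄ := hne _ hd _ hc'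
    refine hnw _ _ hd hc' hdc ?_
    rcases h₃ with h₃ | h₃
    · simp only at h₃ ⊢; omega
    · exact (h₄ (Prod.ext (by simp only at h₃ ⊢; omega) (by simp only at h₃ ⊢; omega))).elim
  · intro hc'
    have h₂ := h'.content_mem _ hc'
    have hcont : content (a, b + 1) = content (a, b) + 1 := by simp [content]; ring
    rcases eq_or_ne (content (a, b + 1)) t' with e | e
    · exact hW a b hc' e (hRS _ hc)
    · obtain ⟨d, hd, hdc⟩ := h'.exists_mem (content (a, b)) (by omega) (by omega)
      have h₃ := h'.step d hd _ hc' (by omega)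
      have h₄ := hne _ hc _ hd
      refine hnw _ _ hc hd hdc.symm ?_
      rcases h₃ with h₃ | h₃
      · exact (h₄ (Prod.ext (by simp only at h₃ ⊢; omega) (by simp only at h₃ ⊢; omega))).elim
      · simp only at h₃ ⊢; omega

end Strips

/-! ### Removing and adding the last ribbon of a tableau -/

section Fillings

variable {n r s : ℕ} {o : LinearOrder (Fin r ⊕ Fin s)} {mu nu lam : YoungDiagram}

/-- A super ribbon tableau of shape `lam / mu`, presented as the set of its labelled ribbons. -/
structure IsFilling (n : ℕ) {r s : ℕ} (o : LinearOrder (Fin r ⊕ Fin s)) (mu lam : YoungDiagram)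
    (F : Finset ((Fin r ⊕ Fin s) × Finset (ℕ × ℕ))) : Prop where
  le : mu ≤ lam
  disjoint : ∀ p ∈ F, ∀ p' ∈ F, p ≠ p' → Disjoint p.2 p'.2
  cover : ∀ c, c ∈ skewCells lam mu ↔ ∃ p ∈ F, c ∈ p.2
  ribbon : ∀ p ∈ F, IsRibbon n p.2
  horizontal : ∀ a, IsHorizontalStrip ((F.filter fun p => p.1 = Sum.inl a).image Prod.snd)
  vertical : ∀ b, IsVerticalStrip ((F.filter fun p => p.1 = Sum.inr b).image Prod.snd)
  initial : ∀ k, ∃ nu : YoungDiagram, mu ≤ nu ∧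
    ∀ c, c ∈ skewCells nu mu ↔ ∃ p ∈ F, o.le p.1 k ∧ c ∈ p.2

/-- The order in which the ribbons of a tableau are added: by label, and for equal labels by
increasing content in a horizontal strip and by decreasing content in a vertical strip. -/
def StepLT (o : LinearOrder (Fin r ⊕ Fin s)) (p p' : (Fin r ⊕ Fin s) × ℤ) : Prop :=
  o.lt p.1 p'.1 ∨ (p.1 = p'.1 ∧ if p'.1.isLeft then p.2 < p'.2 else p'.2 < p.2)

theorem forall_horizontal_iff (hn : 1 ≤ n) {F : Finset ((Fin r ⊕ Fin s) × Finset (ℕ × ℕ))}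
    (hF : ∀ p ∈ F, IsRibbon n p.2) :
    (∀ x, IsHorizontalStrip ((F.filter fun p => p.1 = Sum.inl x).image Prod.snd)) ↔
      ∀ p ∈ F, p.1.isLeft → ∀ p' ∈ F, p'.1 = p.1 → ∀ a b : ℕ, (a + 1, b) ∈ p.2 →
        content (a + 1, b) = tail p.2 + n - 1 → (a, b) ∉ p'.2 := by
  have hrib : ∀ x, ∀ R ∈ (F.filter fun p => p.1 = Sum.inl x).image Prod.snd, IsRibbon n R := by
    intro x R hR
    obtain ⟨p, hp, rfl⟩ := mem_image.1 hR
    exact hF p (mem_filter.1 hp).1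
  simp only [isHorizontalStrip_iff hn (hrib _), mem_image, mem_filter]
  constructor
  · intro h p hp hl p' hp' hpp
    obtain ⟨x, hx⟩ := Sum.isLeft_iff.1 hl
    exact h x p.2 ⟨p, ⟨hp, hx⟩, rfl⟩ p'.2 ⟨p', ⟨hp', hpp.trans hx⟩, rfl⟩
  · rintro h x _ ⟨p, ⟨hp, hx⟩, rfl⟩ _ ⟨p', ⟨hp', hx'⟩, rfl⟩
    exact h p hp (by simp [hx]) p' hp' (hx'.trans hx.symm)

theorem forall_vertical_iff (hn : 1 ≤ n) {F : Finset ((Fin r ⊕ Fin s) × Finset (ℕ × ℕ))}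
    (hF : ∀ p ∈ F, IsRibbon n p.2) :
    (∀ x, IsVerticalStrip ((F.filter fun p => p.1 = Sum.inr x).image Prod.snd)) ↔
      ∀ p ∈ F, p.1.isRight → ∀ p' ∈ F, p'.1 = p.1 → ∀ a b : ℕ, (a, b + 1) ∈ p.2 →
        content (a, b + 1) = tail p.2 → (a, b) ∉ p'.2 := by
  have hrib : ∀ x, ∀ R ∈ (F.filter fun p => p.1 = Sum.inr x).image Prod.snd, IsRibbon n R := by
    intro x R hR
    obtain ⟨p, hp, rfl⟩ := mem_image.1 hR
    exact hF p (mem_filter.1 hp).1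
  simp only [isVerticalStrip_iff hn (hrib _), mem_image, mem_filter]
  constructor
  · intro h p hp hl p' hp' hpp
    obtain ⟨x, hx⟩ := Sum.isRight_iff.1 hl
    exact h x p.2 ⟨p, ⟨hp, hx⟩, rfl⟩ p'.2 ⟨p', ⟨hp', hpp.trans hx⟩, rfl⟩
  · rintro h x _ ⟨p, ⟨hp, hx⟩, rfl⟩ _ ⟨p', ⟨hp', hx'⟩, rfl⟩
    exact h p hp (by simp [hx]) p' hp' (hx'.trans hx.symm)

variable {F : Finset ((Fin r ⊕ Fin s) × Finset (ℕ × ℕ))}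

namespace IsFilling

theorem mem_lam (h : IsFilling n o mu lam F) {p : (Fin r ⊕ Fin s) × Finset (ℕ × ℕ)} (hp : p ∈ F)
    {c : ℕ × ℕ} (hc : c ∈ p.2) : c ∈ lam ∧ c ∉ mu := by
  simpa [skewCells] using (h.cover c).2 ⟨p, hp, hc⟩

theorem eq_of_mem (h : IsFilling n o mu lam F) {p p' : (Fin r ⊕ Fin s) × Finset (ℕ × ℕ)}
    (hp : p ∈ F) (hp' : p' ∈ F) {c : ℕ × ℕ} (hc : c ∈ p.2) (hc' : c ∈ p'.2) : p = p' := by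
  by_contra hne
  exact disjoint_left.1 (h.disjoint p hp p' hp' hne) hc hc'

/-- Boxes to the northwest have weakly smaller labels. -/
theorem label_mono (h : IsFilling n o mu lam F) {p p' : (Fin r ⊕ Fin s) × Finset (ℕ × ℕ)}
    (hp : p ∈ F) (hp' : p' ∈ F) {c c' : ℕ × ℕ} (hc : c ∈ p.2) (hc' : c' ∈ p'.2) (hcc : c ≤ c') :
    o.le p.1 p'.1 := by
  obtain ⟨nu, hnu, hmem⟩ := h.initial p'.1
  have h₁ := (hmem c').2 ⟨p', hp', o.le_refl _, hc'⟩
  have h₂ : c ∈ skewCells nu mu := by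
    simp only [skewCells, mem_sdiff, YoungDiagram.mem_cells] at h₁ ⊢
    exact ⟨nu.isLowerSet hcc h₁.1, (h.mem_lam hp hc).2⟩
  obtain ⟨p'', hp'', hle, hc''⟩ := (hmem c).1 h₂
  obtain rfl := h.eq_of_mem hp hp'' hc hc''
  exact hle

theorem exists_mem_of_le (h : IsFilling n o mu lam F)
    {p : (Fin r ⊕ Fin s) × Finset (ℕ × ℕ)} (hp : p ∈ F) {c c' : ℕ × ℕ} (hc : c ∈ p.2)
    (hc' : c' ∈ lam) (hcc : c ≤ c') : ∃ p' ∈ F, c' ∈ p'.2 := by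
  refine (h.cover c').1 ?_
  simp only [skewCells, mem_sdiff, YoungDiagram.mem_cells]
  exact ⟨hc', fun hmu => (h.mem_lam hp hc).2 (mu.isLowerSet hcc hmu)⟩

/-- A box between two boxes of label `k` has its label squeezed by `label_mono`. -/
theorem ordConnected_label (h : IsFilling n o mu lam F) (k : Fin r ⊕ Fin s) :
    {c | ∃ p ∈ F, p.1 = k ∧ c ∈ p.2}.OrdConnected := by
  constructor
  rintro x ⟨p, hp, rfl, hx⟩ z ⟨p', hp', hpp, hz⟩ y ⟨hxy, hyz⟩
  obtain ⟨p'', hp'', hy⟩ := h.exists_mem_of_le hp hx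
    (lam.isLowerSet hyz (h.mem_lam hp' hz).1) hxy
  refine ⟨p'', hp'', o.le_antisymm _ _ ?_ (h.label_mono hp hp'' hx hy hxy), hy⟩
  rw [← hpp]
  exact h.label_mono hp'' hp' hy hz hyz

/-- For different labels this is monotonicity of labels; for equal labels it is the strip lemma of
the matching kind. Consequently nothing in the shape blocks removal of the last ribbon. -/
theorem notMem_succ (hn : 1 ≤ n) (h : IsFilling n o mu lam F)
    {p p' : (Fin r ⊕ Fin s) × Finset (ℕ × ℕ)} (hp : p ∈ F) (hp' : p' ∈ F)
    (hlt : StepLT o (p'.1, tail p'.2) (p.1, tail p.2)) {a b : ℕ} (hc : (a, b) ∈ p.2) :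
    (a + 1, b) ∉ p'.2 ∧ (a, b + 1) ∉ p'.2 := by
  rcases hlt with hlt | ⟨heq, hlt⟩
  · have hnle := (o.lt_iff_le_not_ge _ _).1 hlt
    exact ⟨fun hc' => hnle.2 (h.label_mono hp hp' hc hc' (by simp)),
      fun hc' => hnle.2 (h.label_mono hp hp' hc hc' (by simp))⟩
  · have hne : p ≠ p' := by
      rintro rfl
      simp at hlt
    have hpath := (h.ribbon p hp).isPath_tail
    have hpath' := (h.ribbon p' hp').isPath_tail
    have hS := h.ordConnected_label p.1
    simp only at heq hlt
    by_cases hl : p.1.isLeft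
    · rw [if_pos hl] at hlt
      refine hpath.not_succ_of_north hpath' hlt.le (h.disjoint p hp p' hp' hne) hS
        (fun c hc => ⟨p, hp, rfl, hc⟩) (fun c hc => ⟨p', hp', heq, hc⟩) ?_ hc
      rintro x y hxy hcont ⟨p'', hp'', hpp, hmem⟩
      exact (forall_horizontal_iff hn h.ribbon).1 h.horizontal p' hp' (by rw [heq]; exact hl) p''
        hp'' (hpp.trans heq.symm) x y hxy hcont hmem
    · rw [if_neg hl] at hlt
      refine hpath.not_succ_of_west hpath' hlt.le (h.disjoint p hp p' hp' hne) hS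
        (fun c hc => ⟨p, hp, rfl, hc⟩) (fun c hc => ⟨p', hp', heq, hc⟩) ?_ hc
      rintro x y hxy hcont ⟨p'', hp'', hpp, hmem⟩
      exact (forall_vertical_iff hn h.ribbon).1 h.vertical p' hp'
        (by rw [heq]; simpa using hl) p''
        hp'' (hpp.trans heq.symm) x y hxy hcont hmem

/-- The last ribbon can be removed. -/
theorem erase (hn : 1 ≤ n) (h : IsFilling n o mu lam F)
    {p : (Fin r ⊕ Fin s) × Finset (ℕ × ℕ)} (hp : p ∈ F)
    (hmax : ∀ p' ∈ F, p' ≠ p → StepLT o (p'.1, tail p'.2) (p.1, tail p.2)) :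
    ∃ nu, IsRibbonStep n (tail p.2) nu lam ∧ skewCells lam nu = p.2 ∧
      IsFilling n o mu nu (F.erase p) := by
  have hnot : ∀ {a b : ℕ} {c' : ℕ × ℕ}, (a, b) ∈ p.2 → c' ∈ lam → c' ∉ p.2 →
      c' ≠ (a + 1, b) ∧ c' ≠ (a, b + 1) := by
    intro a b c' hc hc' hcp
    refine ⟨?_, ?_⟩
    · rintro rfl
      obtain ⟨p', hp', hmem⟩ := h.exists_mem_of_le hp hc hc' (by simp)
      exact (h.notMem_succ hn hp hp' (hmax p' hp' fun e => hcp (e ▸ hmem)) hc).1 hmem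
    · rintro rfl
      obtain ⟨p', hp', hmem⟩ := h.exists_mem_of_le hp hc hc' (by simp)
      exact (h.notMem_succ hn hp hp' (hmax p' hp' fun e => hcp (e ▸ hmem)) hc).2 hmem
  have hlow : IsLowerSet ((lam.cells \ p.2 : Finset (ℕ × ℕ)) : Set (ℕ × ℕ)) := by
    refine isLowerSet_of_pred ?_ ?_ <;> intro a b hab <;>
      rw [mem_sdiff, YoungDiagram.mem_cells] at hab ⊢
    · exact ⟨lam.up_left_mem (Nat.le_succ a) le_rfl hab.1, fun hc => (hnot hc hab.1 hab.2).1 rfl⟩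
    · exact ⟨lam.up_left_mem le_rfl (Nat.le_succ b) hab.1, fun hc => (hnot hc hab.1 hab.2).2 rfl⟩
  let nu : YoungDiagram := ⟨lam.cells \ p.2, hlow⟩
  have hmem : ∀ c, c ∈ nu ↔ c ∈ lam ∧ c ∉ p.2 := fun c => by
    rw [← YoungDiagram.mem_cells]
    simp [nu]
  have hle : nu ≤ lam := fun c hc => ((hmem c).1 hc).1
  have hskew : skewCells lam nu = p.2 := by
    ext c
    simp only [skewCells, mem_sdiff, YoungDiagram.mem_cells, hmem]
    have := fun hc => (h.mem_lam hp (c := c) hc).1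
    tauto
  have hlabel : ∀ p' ∈ F, o.le p'.1 p.1 := by
    intro p' hp'
    rcases eq_or_ne p' p with rfl | hne
    · exact o.le_refl _
    · rcases hmax p' hp' hne with hlt | heq
      · exact ((o.lt_iff_le_not_ge _ _).1 hlt).1
      · have : p'.1 = p.1 := heq.1
        rw [this]
        exact o.le_refl _
  have hrib : ∀ p' ∈ F.erase p, IsRibbon n p'.2 := fun p' hp' => h.ribbon p' (mem_of_mem_erase hp')
  have hmunu : mu ≤ nu := fun c hc => (hmem c).2 ⟨h.le hc, fun hcp => (h.mem_lam hp hcp).2 hc⟩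
  have hcover : ∀ c, c ∈ skewCells nu mu ↔ ∃ p' ∈ F.erase p, c ∈ p'.2 := by
    intro c
    have hc := h.cover c
    simp only [skewCells, mem_sdiff, YoungDiagram.mem_cells, hmem, mem_erase] at hc ⊢
    constructor
    · rintro ⟨⟨h₁, h₂⟩, h₃⟩
      obtain ⟨p', hp', hcp'⟩ := hc.1 ⟨h₁, h₃⟩
      exact ⟨p', ⟨fun e => h₂ (e ▸ hcp'), hp'⟩, hcp'⟩
    · rintro ⟨p', ⟨hne, hp'⟩, hcp'⟩
      have := hc.2 ⟨p', hp', hcp'⟩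
      exact ⟨⟨this.1, fun hcp => hne (h.eq_of_mem hp' hp hcp' hcp)⟩, this.2⟩
  refine ⟨nu, IsPath.isRibbonStep hle (hskew ▸ (h.ribbon p hp).isPath_tail), hskew, hmunu,
    fun p₁ h₁ p₂ h₂ => h.disjoint p₁ (mem_of_mem_erase h₁) p₂ (mem_of_mem_erase h₂), hcover, hrib,
    ?_, ?_, ?_⟩
  · have := (forall_horizontal_iff hn h.ribbon).1 h.horizontal
    exact (forall_horizontal_iff hn hrib).2 fun p₁ h₁ hl p₂ h₂ =>
      this p₁ (mem_of_mem_erase h₁) hl p₂ (mem_of_mem_erase h₂)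
  · have := (forall_vertical_iff hn h.ribbon).1 h.vertical
    exact (forall_vertical_iff hn hrib).2 fun p₁ h₁ hl p₂ h₂ =>
      this p₁ (mem_of_mem_erase h₁) hl p₂ (mem_of_mem_erase h₂)
  · intro k
    by_cases hk : o.le p.1 k
    · refine ⟨nu, hmunu, fun c => (hcover c).trans ?_⟩
      constructor
      · rintro ⟨p', hp', hc⟩
        exact ⟨p', hp', o.le_trans _ _ _ (hlabel p' (mem_of_mem_erase hp')) hk, hc⟩
      · rintro ⟨p', hp', -, hc⟩
        exact ⟨p', hp', hc⟩
    · obtain ⟨kap, hkap, hc⟩ := h.initial k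
      refine ⟨kap, hkap, fun c => (hc c).trans ?_⟩
      constructor
      · rintro ⟨p', hp', hle, hc⟩
        exact ⟨p', mem_erase.2 ⟨fun e => hk (e ▸ hle), hp'⟩, hle, hc⟩
      · rintro ⟨p', hp', hle, hc⟩
        exact ⟨p', mem_of_mem_erase hp', hle, hc⟩

/-- A ribbon can be added after all others. -/
theorem insert (hn : 1 ≤ n) (h : IsFilling n o mu nu F) {k : Fin r ⊕ Fin s} {i : ℤ}
    (hstep : IsRibbonStep n i nu lam) (hmax : ∀ p' ∈ F, StepLT o (p'.1, tail p'.2) (k, i)) :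
    IsFilling n o mu lam (insert (k, skewCells lam nu) F) := by
  have hR := hstep.isRibbon hn
  have htail := hstep.tail_eq hn
  have hpath := hR.isPath_tail
  rw [htail] at hpath
  have hdisj : ∀ p ∈ F, Disjoint p.2 (skewCells lam nu) := by
    intro p hp
    refine disjoint_left.2 fun c hc hc' => ?_
    simp only [skewCells, mem_sdiff, YoungDiagram.mem_cells] at hc'
    exact hc'.2 (h.mem_lam hp hc).1
  have hlabel : ∀ p' ∈ F, o.le p'.1 k := by
    intro p' hp'
    rcases hmax p' hp' with hlt | heq
    · exact ((o.lt_iff_le_not_ge _ _).1 hlt).1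
    · have : p'.1 = k := heq.1
      rw [this]
      exact o.le_refl _
  have hrib : ∀ p ∈ Insert.insert (k, skewCells lam nu) F, IsRibbon n p.2 := by
    intro p hp
    rcases mem_insert.1 hp with rfl | hp
    · exact hR
    · exact h.ribbon p hp
  have hcover : ∀ c, c ∈ skewCells lam mu ↔
      ∃ p ∈ Insert.insert (k, skewCells lam nu) F, c ∈ p.2 := by
    intro c
    have hc := h.cover c
    rw [exists_mem_insert, ← hc]
    simp only [skewCells, mem_sdiff, YoungDiagram.mem_cells]
    have h₁ := fun hc => hstep.le (x := c) hc
    have h₂ := fun hc => h.le (x := c) hc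
    tauto
  refine ⟨h.le.trans hstep.le, ?_, hcover, hrib, ?_, ?_, ?_⟩
  · intro p hp p' hp' hne
    rcases mem_insert.1 hp with rfl | hp <;> rcases mem_insert.1 hp' with rfl | hp'
    · exact (hne rfl).elim
    · exact (hdisj p' hp').symm
    · exact hdisj p hp
    · exact h.disjoint p hp p' hp' hne
  · rw [forall_horizontal_iff hn hrib]
    intro p hp hl p' hp' hpp a b hab hcont hmem
    have hcont' : content (a, b) = content (a + 1, b) + 1 := by simp [content]; ring
    -- The box above the head of the new ribbon has content `i + n`, beyond the new ribbon and
    -- beyond earlier ones of the same label, whose tails are smaller. A box of the new ribbon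
    -- cannot lie above an old box, since `nu` is a lower set.
    rcases mem_insert.1 hp with rfl | hp <;> rcases mem_insert.1 hp' with rfl | hp'
    · have := (hpath.content_mem _ hmem).2
      simp only [htail] at hcont
      omega
    · have h₁ := ((h.ribbon p' hp').isPath_tail.content_mem _ hmem).2
      have h₂ := hmax p' hp'
      simp only at hpp hl
      simp only [StepLT, hpp, hl, if_true, true_and] at h₂
      simp only [htail] at hcont
      have h₃ := h₂.resolve_left (@lt_irrefl _ o.toPreorder k)
      omega
    · have h₁ := (h.mem_lam hp hab).1
      simp only [skewCells, mem_sdiff, YoungDiagram.mem_cells] at hmem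
      exact hmem.2 (nu.up_left_mem (Nat.le_succ a) le_rfl h₁)
    · exact (forall_horizontal_iff hn h.ribbon).1 h.horizontal p hp hl p' hp' hpp a b hab hcont
        hmem
  · rw [forall_vertical_iff hn hrib]
    intro p hp hl p' hp' hpp a b hab hcont hmem
    have hcont' : content (a, b + 1) = content (a, b) + 1 := by simp [content]; ring
    rcases mem_insert.1 hp with rfl | hp <;> rcases mem_insert.1 hp' with rfl | hp'
    · have := (hpath.content_mem _ hmem).1
      simp only [htail] at hcont
      omega
    · have h₁ := ((h.ribbon p' hp').isPath_tail.content_mem _ hmem).1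
      have h₂ := hmax p' hp'
      simp only at hpp hl
      have hl' : k.isLeft = false := by simpa using hl
      simp only [StepLT, hpp, hl', if_false, true_and, Bool.false_eq_true] at h₂
      simp only [htail] at hcont
      have h₃ := h₂.resolve_left (@lt_irrefl _ o.toPreorder k)
      omega
    · have h₁ := (h.mem_lam hp hab).1
      simp only [skewCells, mem_sdiff, YoungDiagram.mem_cells] at hmem
      exact hmem.2 (nu.up_left_mem le_rfl (Nat.le_succ b) h₁)
    · exact (forall_vertical_iff hn h.ribbon).1 h.vertical p hp hl p' hp' hpp a b hab hcont hmem
  · intro j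
    by_cases hj : o.le k j
    · refine ⟨lam, h.le.trans hstep.le, fun c => (hcover c).trans ?_⟩
      constructor
      · rintro ⟨p', hp', hc⟩
        refine ⟨p', hp', ?_, hc⟩
        rcases mem_insert.1 hp' with rfl | hp'
        · exact hj
        · exact o.le_trans _ _ _ (hlabel p' hp') hj
      · rintro ⟨p', hp', -, hc⟩
        exact ⟨p', hp', hc⟩
    · obtain ⟨kap, hkap, hc⟩ := h.initial j
      refine ⟨kap, hkap, fun c => (hc c).trans ?_⟩
      constructor
      · rintro ⟨p', hp', hle, hc⟩
        exact ⟨p', mem_insert_of_mem hp', hle, hc⟩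
      · rintro ⟨p', hp', hle, hc⟩
        rcases mem_insert.1 hp' with rfl | hp'
        · exact (hj hle).elim
        · exact ⟨p', hp', hle, hc⟩

end IsFilling

end Fillings

/-! ### Fillings as matrix coefficients of operator products -/

section FillingSum

variable {n r s : ℕ} {o : LinearOrder (Fin r ⊕ Fin s)} {mu nu lam : YoungDiagram}
  {S : Type*} [CommRing S]

open Classical in
/-- The fillings of shape `lam / mu`, as a finite set. -/
noncomputable def fillings (n : ℕ) (o : LinearOrder (Fin r ⊕ Fin s)) (mu lam : YoungDiagram) :
    Finset (Finset ((Fin r ⊕ Fin s) × Finset (ℕ × ℕ))) :=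
  ((univ ×ˢ lam.cells.powerset).powerset).filter (IsFilling n o mu lam)

theorem mem_fillings {F : Finset ((Fin r ⊕ Fin s) × Finset (ℕ × ℕ))} :
    F ∈ fillings n o mu lam ↔ IsFilling n o mu lam F := by
  classical
  rw [fillings, mem_filter, and_iff_right_iff_imp, mem_powerset]
  intro h p hp
  rw [mem_product, mem_powerset]
  exact ⟨mem_univ _, fun c hc => (YoungDiagram.mem_cells _).2 (h.mem_lam hp hc).1⟩

open Classical in
/-- The fillings all of whose ribbons are added in one of the given steps. -/
noncomputable def fillingsIn (n : ℕ) (o : LinearOrder (Fin r ⊕ Fin s)) (mu lam : YoungDiagram)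
    (l : List ((Fin r ⊕ Fin s) × ℤ)) : Finset (Finset ((Fin r ⊕ Fin s) × Finset (ℕ × ℕ))) :=
  (fillings n o mu lam).filter fun F => ∀ p ∈ F, (p.1, tail p.2) ∈ l

theorem mem_fillingsIn {l : List ((Fin r ⊕ Fin s) × ℤ)}
    {F : Finset ((Fin r ⊕ Fin s) × Finset (ℕ × ℕ))} :
    F ∈ fillingsIn n o mu lam l ↔ IsFilling n o mu lam F ∧ ∀ p ∈ F, (p.1, tail p.2) ∈ l := by
  classical
  rw [fillingsIn, mem_filter, mem_fillings]

/-- The weight of a filling. -/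
def weight (q : S) (w : Fin r ⊕ Fin s → S) (F : Finset ((Fin r ⊕ Fin s) × Finset (ℕ × ℕ))) : S :=
  ∏ p ∈ F, w p.1 * q ^ spin p.2

/-- Neither of two such ribbons can be northwest of the other, so their tail boxes coincide. Hence
each step is used at most once, as in a product of factors `1 + x u i`. -/
theorem IsFilling.eq_of_step_eq (hn : 1 ≤ n) {F : Finset ((Fin r ⊕ Fin s) × Finset (ℕ × ℕ))}
    (h : IsFilling n o mu lam F) {p p' : (Fin r ⊕ Fin s) × Finset (ℕ × ℕ)} (hp : p ∈ F)
    (hp' : p' ∈ F) (hlabel : p.1 = p'.1) (htail : tail p.2 = tail p'.2) : p = p' := by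
  by_contra hne
  have hnw : ∀ p ∈ F, ∀ p' ∈ F, p ≠ p' → p.1 = p'.1 → tail p.2 = tail p'.2 → ∀ c ∈ p.2,
      ∀ c' ∈ p'.2, content c = content c' → ¬ c.1 < c'.1 := by
    intro p hp p' hp' hne hlabel htail c hc c' hc' hcc
    have hpath := (h.ribbon p hp).isPath_tail
    have hpath' := (h.ribbon p' hp').isPath_tail
    by_cases hl : p'.1.isLeft
    · refine hpath.not_northwest_of_north hpath' htail.ge (h.disjoint p hp p' hp' hne)
        (h.ordConnected_label p.1) (fun c hc => ⟨p, hp, rfl, hc⟩)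
        (fun c hc => ⟨p', hp', hlabel.symm, hc⟩) ?_ hc hc' hcc
      rintro x y hxy hcont ⟨p'', hp'', hpp, hmem⟩
      exact (forall_horizontal_iff hn h.ribbon).1 h.horizontal p' hp' hl p'' hp''
        (hpp.trans hlabel) x y hxy hcont hmem
    · refine hpath.not_northwest_of_west hpath' htail.le (h.disjoint p hp p' hp' hne)
        (h.ordConnected_label p.1) (fun c hc => ⟨p, hp, rfl, hc⟩)
        (fun c hc => ⟨p', hp', hlabel.symm, hc⟩) ?_ hc hc' hcc
      rintro x y hxy hcont ⟨p'', hp'', hpp, hmem⟩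
      exact (forall_vertical_iff hn h.ribbon).1 h.vertical p' hp' (by simpa using hl) p'' hp''
        (hpp.trans hlabel) x y hxy hcont hmem
  obtain ⟨c, hc, hct⟩ := (h.ribbon p hp).isPath_tail.exists_mem (tail p.2) le_rfl (by omega)
  obtain ⟨c', hc', hct'⟩ := (h.ribbon p' hp').isPath_tail.exists_mem (tail p'.2) le_rfl (by omega)
  have h₁ := hnw p hp p' hp' hne hlabel htail c hc c' hc' (by omega)
  have h₂ := hnw p' hp' p hp (Ne.symm hne) hlabel.symm htail.symm c' hc' c hc (by omega)
  have h₃ : c = c' := by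
    refine Prod.ext (by omega) ?_
    simp only [content] at hct hct'
    omega
  exact hne (h.eq_of_mem hp hp' hc (h₃ ▸ hc'))

open Classical in
-- The step `(k, i)` comes after all steps in `l`, so a filling either avoids it or arises by adding
-- that ribbon last; `eq_left` makes the remaining shape unique. This mirrors the two terms of `1 +
-- w k • addRibbon n q i`.
theorem fillingsIn_cons (hn : 1 ≤ n) {k : Fin r ⊕ Fin s} {i : ℤ}
    {l : List ((Fin r ⊕ Fin s) × ℤ)} (hl : ∀ p ∈ l, StepLT o p (k, i))
    (hstep : IsRibbonStep n i nu lam) :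
    fillingsIn n o mu lam ((k, i) :: l) = fillingsIn n o mu lam l ∪
      (fillingsIn n o mu nu l).image (insert (k, skewCells lam nu)) := by
  ext F
  simp only [mem_union, mem_image, mem_fillingsIn, List.mem_cons]
  constructor
  · rintro ⟨hF, hFl⟩
    by_cases hex : ∃ p ∈ F, (p.1, tail p.2) = (k, i)
    · obtain ⟨p, hp, hpk⟩ := hex
      have hne : ∀ p' ∈ F, p' ≠ p → (p'.1, tail p'.2) ∈ l := fun p' hp' hne =>
        (hFl p' hp').resolve_left fun e => by
          rw [← hpk, Prod.mk.injEq] at e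
          exact hne (hF.eq_of_step_eq hn hp' hp e.1 e.2)
      obtain ⟨nu', hnu', hskew, hfill⟩ := hF.erase hn hp fun p' hp' h => by
        rw [hpk]
        exact hl _ (hne p' hp' h)
      rw [Prod.mk.injEq] at hpk
      obtain rfl : nu = nu' := hstep.eq_left (hpk.2 ▸ hnu')
      refine Or.inr ⟨F.erase p, ⟨hfill, fun p' hp' =>
        hne p' (mem_of_mem_erase hp') (ne_of_mem_erase hp')⟩, ?_⟩
      rw [hskew, ← hpk.1]
      exact insert_erase hp
    · push Not at hex
      exact Or.inl ⟨hF, fun p hp => (hFl p hp).resolve_left (hex p hp)⟩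
  · rintro (⟨hF, hFl⟩ | ⟨F', ⟨hF', hFl'⟩, rfl⟩)
    · exact ⟨hF, fun p hp => Or.inr (hFl p hp)⟩
    · refine ⟨hF'.insert hn hstep fun p' hp' => hl _ (hFl' p' hp'), fun p hp => ?_⟩
      rcases mem_insert.1 hp with rfl | hp
      · left
        rw [hstep.tail_eq hn]
      · exact Or.inr (hFl' p hp)

theorem fillingsIn_cons_of_not (hn : 1 ≤ n) {k : Fin r ⊕ Fin s} {i : ℤ}
    {l : List ((Fin r ⊕ Fin s) × ℤ)} (hl : ∀ p ∈ l, StepLT o p (k, i))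
    (hstep : ∀ nu, ¬ IsRibbonStep n i nu lam) :
    fillingsIn n o mu lam ((k, i) :: l) = fillingsIn n o mu lam l := by
  ext F
  simp only [mem_fillingsIn, List.mem_cons]
  refine and_congr_right fun hF => ⟨fun hFl p hp => (hFl p hp).resolve_left fun hpk => ?_,
    fun hFl p hp => Or.inr (hFl p hp)⟩
  obtain ⟨nu, hnu, -⟩ := hF.erase hn hp fun p' hp' hne => by
    rw [hpk]
    refine hl _ ((hFl p' hp').resolve_left fun e => ?_)
    rw [← hpk, Prod.mk.injEq] at e
    exact hne (hF.eq_of_step_eq hn hp' hp e.1 e.2)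
  rw [Prod.mk.injEq] at hpk
  exact hstep nu (hpk.2 ▸ hnu)

theorem sum_fillingsIn_cons (hn : 1 ≤ n) (q : S) (w : Fin r ⊕ Fin s → S) {k : Fin r ⊕ Fin s}
    {i : ℤ} {l : List ((Fin r ⊕ Fin s) × ℤ)} (hl : ∀ p ∈ l, StepLT o p (k, i))
    (hstep : IsRibbonStep n i nu lam) :
    ∑ F ∈ fillingsIn n o mu lam ((k, i) :: l), weight q w F =
      ∑ F ∈ fillingsIn n o mu lam l, weight q w F +
        w k * (q ^ spin (skewCells lam nu) * ∑ F ∈ fillingsIn n o mu nu l, weight q w F) := by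
  classical
  have hnot : ∀ lam', ∀ F ∈ fillingsIn n o mu lam' l, (k, skewCells lam nu) ∉ F := by
    intro lam' F hF hmem
    have h₁ := hl _ ((mem_fillingsIn.1 hF).2 _ hmem)
    rw [hstep.tail_eq hn] at h₁
    rcases h₁ with h₁ | h₁
    · exact @lt_irrefl _ o.toPreorder k h₁
    · simp at h₁
  rw [fillingsIn_cons hn hl hstep, sum_union, sum_image, mul_sum, mul_sum]
  · congr 1
    refine sum_congr rfl fun F hF => ?_
    rw [weight, prod_insert (hnot nu F hF), weight]
    ring
  · intro F hF F' hF' h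
    rw [← erase_insert (hnot nu F hF), ← erase_insert (hnot nu F' hF')]
    exact congrArg (fun G => Finset.erase G (k, skewCells lam nu)) h
  · refine disjoint_left.2 fun F hF hF' => ?_
    obtain ⟨F', -, rfl⟩ := mem_image.1 hF'
    exact hnot lam _ hF (mem_insert_self _ _)

open Classical in
/-- The function that is `1` at the bead configuration of `mu`. -/
noncomputable def vacuum (S : Type*) [CommRing S] (mu : YoungDiagram) : Set ℤ → S :=
  fun C => if C = beads mu then 1 else 0

theorem isFilling_empty_iff : IsFilling n o mu lam ∅ ↔ lam = mu := by
  constructor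
  · intro h
    refine le_antisymm (fun c hc => ?_) h.le
    by_contra hcm
    have := (h.cover c).1 (by
      simp only [skewCells, mem_sdiff]
      exact ⟨hc, hcm⟩)
    simp at this
  · rintro rfl
    refine ⟨le_rfl, by simp, by simp [skewCells], by simp, ?_, ?_, fun k =>
      ⟨lam, le_rfl, by simp [skewCells]⟩⟩ <;>
    simp [IsHorizontalStrip, IsVerticalStrip]

/-- The fillings with ribbons from a list of steps are enumerated by the corresponding product of
operators. -/
theorem steps_prod_apply (hn : 1 ≤ n) (q : S) (w : Fin r ⊕ Fin s → S)
    (l : List ((Fin r ⊕ Fin s) × ℤ)) (hl : l.Pairwise fun p p' => StepLT o p' p)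
    (lam : YoungDiagram) :
    (l.map fun p => 1 + w p.1 • addRibbon n q p.2).prod (vacuum S mu) (beads lam) =
      ∑ F ∈ fillingsIn n o mu lam l, weight q w F := by
  classical
  induction l generalizing lam with
  | nil =>
    have : fillingsIn n o mu lam [] = if lam = mu then {∅} else ∅ := by
      ext F
      rw [mem_fillingsIn]
      split_ifs with h
      · rw [mem_singleton]
        constructor
        · rintro ⟨-, hF⟩
          exact eq_empty_of_forall_notMem fun p hp => by simpa using hF p hp
        · rintro rfl
          exact ⟨isFilling_empty_iff.2 h, by simp⟩
      · simp only [notMem_empty, iff_false]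
        rintro ⟨hF, hFl⟩
        obtain rfl : F = ∅ := eq_empty_of_forall_notMem fun p hp => by simpa using hFl p hp
        exact h (isFilling_empty_iff.1 hF)
    rw [this]
    simp only [List.map_nil, List.prod_nil, Module.End.one_apply, vacuum,
      beads_injective.eq_iff]
    split_ifs <;> simp [weight]
  | cons p l ih =>
    obtain ⟨k, i⟩ := p
    rw [List.pairwise_cons] at hl
    simp only [List.map_cons, List.prod_cons, Module.End.mul_apply, LinearMap.add_apply,
      Module.End.one_apply, LinearMap.smul_apply, Pi.add_apply, Pi.smul_apply, smul_eq_mul,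
      addRibbon_apply]
    rw [ih hl.2]
    split_ifs with hmove
    · obtain ⟨nu, hnu⟩ := exists_isRibbonStep hn hmove
      rw [hnu.moveDown_beads hn, ih hl.2, sum_fillingsIn_cons hn q w hl.1 hnu, hnu.spin_eq hn]
    · rw [fillingsIn_cons_of_not hn hl.1 fun nu h => hmove (h.canMoveDown_beads hn), mul_zero,
        add_zero]

/-- The integers from `L` down to `-L`. -/
def positions (L : ℕ) : List ℤ := (List.range (2 * L + 1)).map fun j : ℕ => (L : ℤ) - j

theorem positions_pairwise (L : ℕ) : (positions L).Pairwise (· > ·) := by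
  rw [positions, List.pairwise_map]
  exact List.pairwise_lt_range.imp fun {a b} h => by omega

theorem mem_positions {L : ℕ} {i : ℤ} (h₁ : -(L : ℤ) ≤ i) (h₂ : i ≤ L) : i ∈ positions L := by
  rw [positions, List.mem_map]
  exact ⟨(L - i).toNat, List.mem_range.2 (by omega), by omega⟩

/-- All steps with positions in `[-L, L]`, the last step first. -/
def allSteps (L : ℕ) (l : List (Fin r ⊕ Fin s)) : List ((Fin r ⊕ Fin s) × ℤ) :=
  l.flatMap fun k => (if k.isLeft then positions L else (positions L).reverse).map (Prod.mk k)

theorem allSteps_pairwise (L : ℕ) {l : List (Fin r ⊕ Fin s)} (hl : l.Pairwise fun a b => o.lt b a) :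
    (allSteps L l).Pairwise fun p p' => StepLT o p' p := by
  rw [allSteps, List.pairwise_flatMap]
  constructor
  · intro k _
    rw [List.pairwise_map]
    split_ifs with hk
    · exact (positions_pairwise L).imp fun h => Or.inr ⟨rfl, by simpa [hk] using h⟩
    · rw [List.pairwise_reverse]
      exact (positions_pairwise L).imp fun h => Or.inr ⟨rfl, by simpa [hk] using h⟩
  · refine hl.imp fun h x hx y hy => ?_
    obtain ⟨_, -, rfl⟩ := List.mem_map.1 hx
    obtain ⟨_, -, rfl⟩ := List.mem_map.1 hy
    exact Or.inl h

theorem allSteps_prod (q : S) (w : Fin r ⊕ Fin s → S) (L : ℕ) (l : List (Fin r ⊕ Fin s)) :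
    ((allSteps L l).map fun p => 1 + w p.1 • addRibbon n q p.2).prod =
      (l.map fun k => signedProd (addRibbon n q) (positions L) (k.isLeft, w k)).prod := by
  induction l with
  | nil => simp [allSteps]
  | cons k l ih =>
    simp only [allSteps, List.flatMap_cons, List.map_append, List.prod_append, List.map_cons,
      List.prod_cons] at ih ⊢
    rw [ih]
    congr 1
    simp [signedProd, factorProd, Function.comp_def]

/-- A bound for the contents of the boxes of a diagram. -/
def contentBound (lam : YoungDiagram) : ℕ := ∑ c ∈ lam.cells, (c.1 + c.2)

theorem abs_content_le {c : ℕ × ℕ} (hc : c ∈ lam) :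
    -(contentBound lam : ℤ) ≤ content c ∧ content c ≤ contentBound lam := by
  have : c.1 + c.2 ≤ contentBound lam :=
    single_le_sum (f := fun c : ℕ × ℕ => c.1 + c.2) (fun _ _ => Nat.zero_le _)
      ((YoungDiagram.mem_cells _).2 hc)
  simp only [content]
  omega

/-- The tail of a ribbon is the content of one of its boxes in `lam`, so truncating the positions
loses no filling. -/
theorem fillingsIn_allSteps (hn : 1 ≤ n) {l : List (Fin r ⊕ Fin s)} (hl : ∀ k, k ∈ l) :
    fillingsIn n o mu lam (allSteps (contentBound lam) l) = fillings n o mu lam := by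
  ext F
  rw [mem_fillingsIn, mem_fillings, and_iff_left_iff_imp]
  intro hF p hp
  obtain ⟨c, hc, hct⟩ := (hF.ribbon p hp).isPath_tail.exists_mem (tail p.2) le_rfl (by omega)
  have hb := abs_content_le (hF.mem_lam hp hc).1
  have hmem := mem_positions hb.1 hb.2
  rw [hct] at hmem
  refine List.mem_flatMap.2 ⟨p.1, hl _, List.mem_map.2 ⟨tail p.2, ?_, rfl⟩⟩
  split_ifs
  · exact hmem
  · exact List.mem_reverse.2 hmem

theorem sum_fillings_eq (hn : 1 ≤ n) (q : S) (w : Fin r ⊕ Fin s → S) {l : List (Fin r ⊕ Fin s)}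
    (hl : l.Pairwise fun a b => o.lt b a) (hl' : ∀ k, k ∈ l) :
    ∑ F ∈ fillings n o mu lam, weight q w F =
      (l.map fun k => signedProd (addRibbon n q) (positions (contentBound lam))
        (k.isLeft, w k)).prod (vacuum S mu) (beads lam) := by
  rw [← allSteps_prod, steps_prod_apply hn q w _ (allSteps_pairwise _ hl), fillingsIn_allSteps hn hl']

theorem exists_sorted_list {α : Type*} [Fintype α] (o : LinearOrder α) :
    ∃ l : List α, (l.Pairwise fun a b => o.lt b a) ∧ ∀ k, k ∈ l :=
  ⟨(univ : Finset α).sort (· ≥ ·), (sortedGT_sort _).pairwise, by simp⟩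

/-- The generating function of fillings depends neither on the order of the labels nor on the
order of the weights of the labels of either kind. -/
theorem sum_fillings_invariant [IsDomain S] (hn : 1 ≤ n) {q : S} (hq : q ≠ 0)
    (w : Fin r ⊕ Fin s → S) (o o' : LinearOrder (Fin r ⊕ Fin s)) (e : Equiv.Perm (Fin r ⊕ Fin s))
    (he : ∀ k, (e k).isLeft = k.isLeft) :
    ∑ F ∈ fillings n o mu lam, weight q (w ∘ e) F = ∑ F ∈ fillings n o' mu lam, weight q w F := by
  obtain ⟨l, hl, hmem⟩ := exists_sorted_list o
  obtain ⟨l', hl', hmem'⟩ := exists_sorted_list o'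
  rw [sum_fillings_eq hn q _ hl hmem, sum_fillings_eq hn q _ hl' hmem']
  have hnd : l.Nodup := hl.imp fun {a b} h => @ne_of_gt _ o.toPreorder _ _ h
  have hnd' : l'.Nodup := hl'.imp fun {a b} h => @ne_of_gt _ o'.toPreorder _ _ h
  -- Both lists enumerate every label exactly once, so the two operator products have the same
  -- factors in different orders; the factors commute.
  have hperm : (l.map e).Perm l' := by
    rw [List.perm_ext_iff_of_nodup (hnd.map e.injective) hnd']
    intro k
    simp only [hmem', iff_true, List.mem_map]
    exact ⟨e.symm k, hmem _, by simp⟩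
  have hmap : (l.map fun k => signedProd (addRibbon n q) (positions (contentBound lam))
      (k.isLeft, (w ∘ e) k)) = (l.map e).map fun k => signedProd (addRibbon n q)
        (positions (contentBound lam)) (k.isLeft, w k) := by
    simp [he, Function.comp_def]
  rw [hmap, (hperm.map _).prod_eq' (List.pairwise_of_forall_mem_list fun a ha b hb => ?_)]
  obtain ⟨k, -, rfl⟩ := List.mem_map.1 ha
  obtain ⟨k', -, rfl⟩ := List.mem_map.1 hb
  exact signedProd_commute addRibbon_sq (addRibbon_aba hn)
    (fun i m j him hmj => addRibbon_commute_commutator hq him hmj) _ (positions_pairwise _) _ _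

end FillingSum

/-! ### From tableaux to fillings and to the polynomial -/

section Tableaux

variable {n r s : ℕ} {o : LinearOrder (Fin r ⊕ Fin s)} {mu lam : YoungDiagram}

namespace SuperRibbonTableau

/-- The set of labelled ribbons of a tableau. -/
def toFilling (T : SuperRibbonTableau n lam mu o) :
    Finset ((Fin r ⊕ Fin s) × Finset (ℕ × ℕ)) :=
  univ.image fun R : {R // R ∈ T.tiling.parts} => (T.label R, R.1)

theorem mem_toFilling {T : SuperRibbonTableau n lam mu o}
    {p : (Fin r ⊕ Fin s) × Finset (ℕ × ℕ)} :
    p ∈ T.toFilling ↔ ∃ h : p.2 ∈ T.tiling.parts, T.label ⟨p.2, h⟩ = p.1 := by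
  obtain ⟨k, R⟩ := p
  simp only [toFilling, mem_image, mem_univ, true_and, Prod.mk.injEq, Subtype.exists]
  constructor
  · rintro ⟨R, h, h', rfl⟩
    exact ⟨h, h'⟩
  · rintro ⟨h, h'⟩
    exact ⟨R, h, h', rfl⟩

theorem image_filter_toFilling (T : SuperRibbonTableau n lam mu o) (k : Fin r ⊕ Fin s) :
    (T.toFilling.filter fun p => p.1 = k).image Prod.snd =
      (univ.filter fun R => T.label R = k).image Subtype.val := by
  ext R
  simp [mem_toFilling]

theorem isFilling_toFilling (hmu : mu ≤ lam) (T : SuperRibbonTableau n lam mu o) :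
    IsFilling n o mu lam T.toFilling where
  le := hmu
  disjoint p hp p' hp' hne := by
    obtain ⟨h, hk⟩ := mem_toFilling.1 hp
    obtain ⟨h', hk'⟩ := mem_toFilling.1 hp'
    refine T.tiling.disjoint h h' fun e => hne (Prod.ext ?_ e)
    rw [← hk, ← hk']
    congr 1
    exact Subtype.ext e
  cover c := by
    rw [← T.tiling.sup_parts, mem_sup]
    constructor
    · rintro ⟨R, hR, hc⟩
      exact ⟨(T.label ⟨R, hR⟩, R), mem_toFilling.2 ⟨hR, rfl⟩, hc⟩
    · rintro ⟨p, hp, hc⟩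
      exact ⟨p.2, (mem_toFilling.1 hp).1, hc⟩
  ribbon p hp := T.ribbon _ (mem_toFilling.1 hp).1
  horizontal a := by
    rw [T.image_filter_toFilling]
    exact T.horizontal a
  vertical b := by
    rw [T.image_filter_toFilling]
    exact T.vertical b
  initial k := by
    obtain ⟨nu, hnu, hc⟩ := T.initial k
    refine ⟨nu, hnu, fun c => (hc c).trans ?_⟩
    constructor
    · rintro ⟨R, hR, hcR⟩
      exact ⟨(T.label R, R.1), mem_toFilling.2 ⟨R.2, rfl⟩, hR, hcR⟩
    · rintro ⟨p, hp, hle, hcp⟩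
      obtain ⟨h, hk⟩ := mem_toFilling.1 hp
      exact ⟨⟨p.2, h⟩, by rw [hk]; exact hle, hcp⟩

theorem toFilling_injective :
    Function.Injective (toFilling : SuperRibbonTableau n lam mu o → _) := by
  intro T T' h
  have hparts : T.tiling = T'.tiling := by
    ext R
    constructor
    · intro hR
      exact (mem_toFilling.1 (h ▸ mem_toFilling.2 ⟨hR, rfl⟩ :
        (T.label ⟨R, hR⟩, R) ∈ T'.toFilling)).1
    · intro hR
      exact (mem_toFilling.1 (h ▸ mem_toFilling.2 ⟨hR, rfl⟩ :
        (T'.label ⟨R, hR⟩, R) ∈ T.toFilling)).1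
  obtain ⟨P, f, _, _, _, _⟩ := T
  obtain ⟨P', f', _, _, _, _⟩ := T'
  obtain rfl : P = P' := hparts
  congr 1
  funext R
  have hR : (f R, R.1) ∈ toFilling _ := h ▸ mem_toFilling.2 ⟨R.2, rfl⟩
  exact (mem_toFilling.1 hR).2.symm

/-- Ribbons are nonempty and those of distinct elements of `F` are disjoint, so a tile occurs in `F`
with only one label, and the labelling of the tiling is well defined. -/
theorem exists_toFilling_eq {F : Finset ((Fin r ⊕ Fin s) × Finset (ℕ × ℕ))}
    (hF : IsFilling n o mu lam F) : ∃ T : SuperRibbonTableau n lam mu o, T.toFilling = F := by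
  have hne : ∀ p ∈ F, p.2.Nonempty := fun p hp => by
    obtain ⟨⟨c, hc⟩⟩ := (hF.ribbon p hp).connected.nonempty
    exact ⟨c, hc⟩
  have hinj : ∀ p ∈ F, ∀ p' ∈ F, p.2 = p'.2 → p = p' := by
    intro p hp p' hp' e
    obtain ⟨c, hc⟩ := hne p hp
    exact hF.eq_of_mem hp hp' hc (e ▸ hc)
  let P : Finpartition (skewCells lam mu) := Finpartition.ofExistsUnique (F.image Prod.snd)
    (by
      intro R hR c hc
      obtain ⟨p, hp, rfl⟩ := mem_image.1 hR
      exact (hF.cover c).2 ⟨p, hp, hc⟩)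
    (by
      intro c hc
      obtain ⟨p, hp, hcp⟩ := (hF.cover c).1 hc
      refine ⟨p.2, ⟨mem_image_of_mem _ hp, hcp⟩, ?_⟩
      rintro R ⟨hR, hcR⟩
      obtain ⟨p', hp', rfl⟩ := mem_image.1 hR
      rw [hF.eq_of_mem hp hp' hcp hcR])
    (by
      intro h
      obtain ⟨p, hp, e⟩ := mem_image.1 h
      exact (hne p hp).ne_empty e)
  have hex : ∀ R : {R // R ∈ P.parts}, ∃ k, (k, R.1) ∈ F := by
    rintro ⟨R, hR⟩
    obtain ⟨p, hp, rfl⟩ := mem_image.1 (show R ∈ F.image Prod.snd from hR)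
    exact ⟨p.1, hp⟩
  choose f hf using hex
  have hmem : ∀ p, p ∈ F ↔ ∃ h : p.2 ∈ P.parts, f ⟨p.2, h⟩ = p.1 := by
    intro p
    constructor
    · intro hp
      have h : p.2 ∈ P.parts := mem_image_of_mem Prod.snd hp
      exact ⟨h, congrArg Prod.fst (hinj _ (hf ⟨p.2, h⟩) p hp rfl)⟩
    · rintro ⟨h, hk⟩
      have := hf ⟨p.2, h⟩
      rwa [hk] at this
  have himage : ∀ k, (F.filter fun p => p.1 = k).image Prod.snd =
      (univ.filter fun R => f R = k).image Subtype.val := by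
    intro k
    ext R
    simp [hmem]
  refine ⟨⟨P, f, ?_, ?_, ?_, ?_⟩, ?_⟩
  · intro R hR
    exact hF.ribbon _ (hf ⟨R, hR⟩)
  · intro a
    rw [← himage]
    exact hF.horizontal a
  · intro b
    rw [← himage]
    exact hF.vertical b
  · intro k
    obtain ⟨nu, hnu, hc⟩ := hF.initial k
    refine ⟨nu, hnu, fun c => (hc c).trans ?_⟩
    constructor
    · rintro ⟨p, hp, hle, hcp⟩
      obtain ⟨h, hk⟩ := (hmem p).1 hp
      exact ⟨⟨p.2, h⟩, by rw [hk]; exact hle, hcp⟩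
    · rintro ⟨R, hle, hcR⟩
      exact ⟨_, hf R, hle, hcR⟩
  · ext p
    rw [mem_toFilling, hmem]

end SuperRibbonTableau

/-- The weights of the labels in the super LLT polynomial. -/
noncomputable def labelWeight (k : Fin r ⊕ Fin s) : MvPolynomial (Fin r ⊕ Fin s) (Polynomial ℤ) :=
  Sum.elim (fun a => MvPolynomial.X (Sum.inl a)) (fun b => -MvPolynomial.X (Sum.inr b)) k

theorem weight_toFilling (T : SuperRibbonTableau n lam mu o) :
    weight (MvPolynomial.C Polynomial.X) labelWeight T.toFilling =
      MvPolynomial.C (Polynomial.X ^ T.spin) *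
        (∏ a : Fin r, MvPolynomial.X (Sum.inl a) ^ T.wt (Sum.inl a)) *
        ∏ b : Fin s, (-MvPolynomial.X (Sum.inr b)) ^ T.wt (Sum.inr b) := by
  rw [weight, SuperRibbonTableau.toFilling, prod_image (by
    intro R _ R' _ h
    exact Subtype.ext (congrArg Prod.snd h)), prod_mul_distrib, mul_comm, mul_assoc]
  congr 1
  · rw [prod_pow_eq_pow_sum, SuperRibbonTableau.spin, map_pow, ← sum_coe_sort T.tiling.parts]
  -- Grouping the tiles by label turns the product of label weights into powers with exponents
  -- `T.wt`.
  · rw [← prod_fiberwise univ T.label, Fintype.prod_sum_type]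
    have key : ∀ k, ∏ R with T.label R = k, labelWeight (T.label R) =
        labelWeight k ^ T.wt k := by
      intro k
      rw [SuperRibbonTableau.wt, ← prod_const]
      exact prod_congr rfl fun R hR => by rw [(mem_filter.1 hR).2]
    simp only [key]
    rfl

theorem superLLT_eq_sum_fillings (hmu : mu ≤ lam) :
    superLLT n lam mu o =
      ∑ F ∈ fillings n o mu lam, weight (MvPolynomial.C Polynomial.X) labelWeight F := by
  refine sum_bij (fun T _ => T.toFilling)
    (fun T _ => mem_fillings.2 (T.isFilling_toFilling hmu))
    (fun T _ T' _ h => SuperRibbonTableau.toFilling_injective h) (fun F hF => ?_)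
    (fun T _ => (weight_toFilling T).symm)
  obtain ⟨T, hT⟩ := SuperRibbonTableau.exists_toFilling_eq (mem_fillings.1 hF)
  exact ⟨T, mem_univ _, hT⟩

/-- Renaming variables amounts to permuting the label weights within each alphabet, which the sum
over fillings does not see. -/
theorem rename_superLLT (hn : 1 ≤ n) (hmu : mu ≤ lam) (o : LinearOrder (Fin r ⊕ Fin s))
    (σ : Equiv.Perm (Fin r)) (τ : Equiv.Perm (Fin s)) :
    MvPolynomial.rename (Sum.map σ τ) (superLLT n lam mu o) = superLLT n lam mu o := by
  have hq : (MvPolynomial.C Polynomial.X : MvPolynomial (Fin r ⊕ Fin s) (Polynomial ℤ)) ≠ 0 := by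
    simp [Polynomial.X_ne_zero]
  have hw : ∀ k : Fin r ⊕ Fin s, MvPolynomial.rename (Sum.map σ τ) (labelWeight k) =
      (labelWeight ∘ Equiv.sumCongr σ τ) k := by
    rintro (a | b) <;> simp [labelWeight]
  rw [superLLT_eq_sum_fillings hmu]
  refine Eq.trans ?_ (sum_fillings_invariant hn hq labelWeight o o (Equiv.sumCongr σ τ)
    (by rintro (a | b) <;> simp))
  rw [map_sum]
  refine sum_congr rfl fun F _ => ?_
  rw [weight, map_prod]
  refine prod_congr rfl fun p _ => ?_
  rw [map_mul, hw, map_pow, MvPolynomial.rename_C]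

theorem superLLT_order_independent (hn : 1 ≤ n) (hmu : mu ≤ lam)
    (o o' : LinearOrder (Fin r ⊕ Fin s)) : superLLT n lam mu o = superLLT n lam mu o' := by
  rw [superLLT_eq_sum_fillings hmu, superLLT_eq_sum_fillings hmu]
  exact sum_fillings_invariant hn (by simp [Polynomial.X_ne_zero]) labelWeight o o' (Equiv.refl _)
    (fun _ => rfl)

end Tableaux

end SuperLLT

theorem mainTheorem7 (n : ℕ) (hn : 1 ≤ n) (lam mu : YoungDiagram) (hmu : mu ≤ lam) (r s : ℕ) :
    (∀ o : LinearOrder (Fin r ⊕ Fin s), SuperLLT.RespectsAlphabets o →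
      (∀ σ : Equiv.Perm (Fin r),
        MvPolynomial.rename (Sum.map σ id) (SuperLLT.superLLT n lam mu o) =
          SuperLLT.superLLT n lam mu o) ∧
      (∀ τ : Equiv.Perm (Fin s),
        MvPolynomial.rename (Sum.map id τ) (SuperLLT.superLLT n lam mu o) =
          SuperLLT.superLLT n lam mu o)) ∧
    (∀ o o' : LinearOrder (Fin r ⊕ Fin s),
      SuperLLT.RespectsAlphabets o → SuperLLT.RespectsAlphabets o' →
        SuperLLT.superLLT n lam mu o = SuperLLT.superLLT n lam mu o') :=
  ⟨fun o _ => ⟨fun σ => SuperLLT.rename_superLLT hn hmu o σ 1,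
    fun τ => SuperLLT.rename_superLLT hn hmu o 1 τ⟩,
    fun o o' _ _ => SuperLLT.superLLT_order_independent hn hmu o o'⟩
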